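/- Let $G=(V,E)$ be a finite tree (a connected acyclic simple graph, with at least one vertex). A *search tree* on a connected graph $G$ is a rooted tree $T$ with vertex set $V$, defined recursively: it consists of a root $r\in V$ connected to the roots of search trees on the connected components of $G-r$, one for each component (if $|V|=1$, then $T$ is the single vertex $r$). If $v$ is a child of $u$ in $T$, the *rotation* on $u$ and $v$ makes $u$ a child of $v$, makes $v$ a child of the former parent of $u$ (or the root, if $u$ was the root), makes those subtrees hanging from $v$ that contain a $G$-neighbour of $u$ subtrees of $u$, and changes nothing else. The *rotation graph* $\mathcal R(G)$ has the search trees on $G$ as vertices, two of them being adjacent if and only if they differ by a single rotation; $\delta(\mathcal R(G))$ denotes its diameter. **Theorem.** For every $n\ge 1$ the maximum $$D(n)=\max\{\delta(\mathcal R(G)) : G \text{ a tree on } n \text{ vertices}\}$$ exists and is finite, and $D(n)=\Theta(n\log n)$ as $n\to\infty$. Moreover, the order of magnitude of the lower bound is attained by complete binary trees: if $G_k$ is the complete binary tree with $k$ levels, on $n_k=2^k-1$ vertices, then $\delta(\mathcal R(G_k))=\Omega(n_k\log n_k)$ as $k\to\infty$. -/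

import Mathlib

open Filter Asymptotics

universe u

/-- Rooted forests on the vertex set `V` are encoded by their parent function `p`; `p v = none`
says that `v` is a root. `IsSearchTreeOn G p S r` says that the part of `p` lying on `S` is a search
tree on the induced subgraph `G[S]` with root `r`: the vertex `r` lies in `S`, and for every connected
component `C` of `G[S] - r` there is a search tree on `C` whose root is a child of `r`.
If `S = {r}` there is no such component, and the search tree is the single vertex `r`. -/
inductive IsSearchTreeOn {V : Type u} (G : SimpleGraph V) (p : V → Option V) : Set V → V → Prop
  | intro (S : Set V) (r : V) (root_mem : r ∈ S)
      (child : (G.induce (S \ {r})).ConnectedComponent → V)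
      (parent_child : ∀ C, p (child C) = some r)
      (subtree : ∀ C, IsSearchTreeOn G p (Subtype.val '' C.supp) (child C)) :
      IsSearchTreeOn G p S r

/-- A search tree on the graph `G`, given by its parent function (the root has no parent). -/
@[ext]
structure SearchTree {V : Type u} (G : SimpleGraph V) where
  parent : V → Option V
  exists_root : ∃ r : V, parent r = none ∧ IsSearchTreeOn G parent Set.univ r

/-- The vertex set of the subtree rooted at `x`: all vertices from which `x` is reached by repeatedly
passing to the parent (`x` itself included). -/
def subtreeVerts {V : Type u} (p : V → Option V) (x : V) : Set V :=
  {y | Relation.ReflTransGen (fun a b => p a = some b) y x}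

open Classical in
/-- The parent function after the rotation on `u` and `v`, where `v` is a child of `u`:
`v` becomes a child of the former parent of `u` (or the root, if `u` was the root), `u` becomes a
child of `v`, every subtree of `v` containing a `G`-neighbour of `u` becomes a subtree of `u`, and
all other parents are unchanged. -/
noncomputable def rotate {V : Type u} (G : SimpleGraph V) (p : V → Option V) (u v : V) :
    V → Option V := fun x =>
  if x = v then p u
  else if x = u then some v
  else if p x = some v ∧ ∃ y ∈ subtreeVerts p x, G.Adj u y then some u
  else p x

/-- The rotation graph of `G`: its vertices are the search trees on `G`, two of them being adjacent
if and only if they differ by a single rotation. -/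
def rotationGraph {V : Type u} (G : SimpleGraph V) : SimpleGraph (SearchTree G) :=
  SimpleGraph.fromRel fun T T' =>
    ∃ u v : V, T.parent v = some u ∧ T'.parent = rotate G T.parent u v

/-- The complete binary tree with `k` levels: its vertices are the binary words of length less
than `k`, and each word `w` of length less than `k - 1` is joined to its two one-letter extensions. -/
def completeBinaryTree (k : ℕ) : SimpleGraph {w : List Bool // w.length < k} :=
  SimpleGraph.fromRel fun w w' => ∃ b : Bool, w'.1 = w.1 ++ [b]

/-! Upper bound. The ancestor relation determines a search tree. If `T ≠ T'`, some rotation of `T`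
removes a pair that the two trees order oppositely and creates no new one
(`IsElimTree.exists_rotate_reversedPairs`), so the rotation distance is at most the number of such
pairs. Removing centroids recursively gives a tree `T₀` of depth at most `log₂ n`; each vertex has
at most `log₂ n` proper ancestors in `T₀`, so every search tree is within `n log₂ n` rotations of
`T₀`, and the diameter is at most `2 n log₂ n` (`ediam_rotationGraph_le`).

Lower bound. Let the vertices be binary words, a prefix-closed set. For each word `w`, label the
words extending `w` by their next letter (`w` itself gets a third label) and count the label changes
on the way from `w` to the root of a search tree. A rotation of `u` and `v` can alter this count
only if `w` is the longest common prefix of `u` and `v`, and then by at most two; so the sum over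
all `w` of length less than `m` moves by at most two per rotation
(`IsSeparatedLabelling.sum_rotate_le`). The sum is zero for the word tree rooted at the empty word.
In a search tree whose top is a path through the words of length `m` in bit-reversed order, the
labels alternate fully, and each `w` contributes at least `2 ^ (m - |w|) - 1`, in total at least `m
2 ^ m - 2 ^ m`. Hence `IsWordTree.le_diam`. Words longer than `m` do no harm, so this covers trees
of every large size as well as complete binary trees. -/

/-! ### Subtrees of parent functions, depth, and connectedness inside a set -/

section Basic

variable {V : Type u} {G : SimpleGraph V} {p : V → Option V}

theorem mem_subtreeVerts_self (p : V → Option V) (x : V) : x ∈ subtreeVerts p x :=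
  Relation.ReflTransGen.refl

theorem mem_subtreeVerts_trans {x y z : V} (h : x ∈ subtreeVerts p y) (h' : y ∈ subtreeVerts p z) :
    x ∈ subtreeVerts p z :=
  Relation.ReflTransGen.trans h h'

theorem mem_subtreeVerts_of_parent {x y : V} (h : p x = some y) : x ∈ subtreeVerts p y :=
  Relation.ReflTransGen.single h

/-- Unfolding membership in a subtree at the lower end. -/
theorem mem_subtreeVerts_iff {x y : V} :
    y ∈ subtreeVerts p x ↔ y = x ∨ ∃ z, p y = some z ∧ z ∈ subtreeVerts p x := by
  constructor
  · intro h
    rcases Relation.ReflTransGen.cases_head h with h | ⟨z, h1, h2⟩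
    · exact Or.inl h
    · exact Or.inr ⟨z, h1, h2⟩
  · rintro (rfl | ⟨z, h1, h2⟩)
    · exact mem_subtreeVerts_self _ _
    · exact mem_subtreeVerts_trans (mem_subtreeVerts_of_parent h1) h2

theorem mem_subtreeVerts_iff_of_parent {x y z : V} (h : p y = some z) :
    y ∈ subtreeVerts p x ↔ y = x ∨ z ∈ subtreeVerts p x := by
  rw [mem_subtreeVerts_iff]; simp [h]

/-- Unfolding membership in a subtree at the upper end. -/
theorem mem_subtreeVerts_iff_child {x y : V} :
    y ∈ subtreeVerts p x ↔ y = x ∨ ∃ c, p c = some x ∧ y ∈ subtreeVerts p c := by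
  constructor
  · intro h
    rcases Relation.ReflTransGen.cases_tail h with h | ⟨z, h1, h2⟩
    · exact Or.inl h.symm
    · exact Or.inr ⟨z, h2, h1⟩
  · rintro (rfl | ⟨z, h1, h2⟩)
    · exact mem_subtreeVerts_self _ _
    · exact mem_subtreeVerts_trans h2 (mem_subtreeVerts_of_parent h1)

theorem subtreeVerts_total {x a b : V} (ha : x ∈ subtreeVerts p a) (hb : x ∈ subtreeVerts p b) :
    a ∈ subtreeVerts p b ∨ b ∈ subtreeVerts p a := by
  refine Relation.ReflTransGen.total_of_right_unique (fun a b c h h' => ?_) ha hb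
  simpa [h] using h'

/-- A recursive description of the subtree at `x`, valid along a decreasing measure, is correct. -/
theorem mem_subtreeVerts_iff_of_measure (m : V → ℕ) (hm : ∀ x y, p x = some y → m y < m x) {x : V}
    (F : V → Prop) (hF : ∀ y, F y ↔ y = x ∨ ∃ z, p y = some z ∧ F z) (y : V) :
    y ∈ subtreeVerts p x ↔ F y := by
  induction hn : m y using Nat.strong_induction_on generalizing y with
  | _ n ih =>
    rw [mem_subtreeVerts_iff, hF]
    refine or_congr_right (exists_congr fun z => and_congr_right fun hz => ?_)
    exact ih _ (hn ▸ hm _ _ hz) z rfl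

/-- If some root is reached from everywhere, there is a depth function. -/
theorem exists_depth (h : ∃ r, p r = none ∧ ∀ y, y ∈ subtreeVerts p r) :
    ∃ d : V → ℕ, ∀ x y, p x = some y → d x = d y + 1 := by
  classical
  obtain ⟨r, hr, hall⟩ := h
  have key : ∀ y, ∃ k, (fun o : Option V => o.bind p)^[k] (some y) = none := by
    intro y
    refine Relation.ReflTransGen.head_induction_on (hall y) ⟨1, by simp [hr]⟩ ?_
    rintro a c hac - ⟨k, hk⟩
    exact ⟨k + 1, by simpa [Function.iterate_succ_apply, hac] using hk⟩
  -- The depth counts the iterations of the parent map until it runs off the root, so the root has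
  -- depth 1; only comparisons and differences of depths matter.
  refine ⟨fun y => Nat.find (key y), fun x y hxy => ?_⟩
  rw [Nat.find_eq_iff]
  constructor
  · simpa [Function.iterate_succ_apply, hxy] using Nat.find_spec (key y)
  · intro n hn
    cases n with
    | zero => simp
    | succ n => simpa [Function.iterate_succ_apply, hxy] using Nat.find_min (key y) (Nat.lt_of_succ_lt_succ hn)

/-- Being joined by a walk inside `S`. -/
def JoinedInside (G : SimpleGraph V) (S : Set V) : V → V → Prop :=
  Relation.ReflTransGen fun a b => G.Adj a b ∧ a ∈ S ∧ b ∈ S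

theorem JoinedInside.symm {S : Set V} {a b : V} (h : JoinedInside G S a b) :
    JoinedInside G S b a := by
  induction h with
  | refl => exact .refl
  | tail _ h ih => exact .head ⟨h.1.symm, h.2.2, h.2.1⟩ ih

theorem JoinedInside.mono {S S' : Set V} (hS : S ⊆ S') {a b : V} (h : JoinedInside G S a b) :
    JoinedInside G S' a b :=
  Relation.ReflTransGen.mono (fun _ _ h => ⟨h.1, hS h.2.1, hS h.2.2⟩) _ _ h

theorem JoinedInside.mem_of_closed {S A : Set V} {a b : V} (h : JoinedInside G S a b) (ha : a ∈ A)
    (hA : ∀ x y, x ∈ A → x ∈ S → y ∈ S → G.Adj x y → y ∈ A) : b ∈ A := by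
  induction h with
  | refl => exact ha
  | tail _ h ih => exact hA _ _ ih h.2.1 h.2.2 h.1

/-- All pairs of vertices of `S` are joined by walks inside `S`. -/
def PreconnectedSet (G : SimpleGraph V) (S : Set V) : Prop :=
  ∀ a ∈ S, ∀ b ∈ S, JoinedInside G S a b

theorem reachable_induce_iff {S : Set V} (a b : S) :
    (G.induce S).Reachable a b ↔ JoinedInside G S a b := by
  rw [SimpleGraph.reachable_iff_reflTransGen]
  constructor
  · intro h
    induction h with
    | refl => exact .refl
    | tail _ h ih => exact ih.tail ⟨h, Subtype.prop _, Subtype.prop _⟩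
  · intro h
    obtain ⟨a, ha⟩ := a
    obtain ⟨b, hb⟩ := b
    simp only at h
    induction h with
    | refl => exact .refl
    | tail _ h ih => exact (ih h.2.1).tail h.1

end Basic

/-- Parent functions of search trees, described without recursion: there is a root reached from
everywhere, adjacent vertices of `G` are comparable, and the subtree of every child contains a
neighbour of its parent. -/
structure IsElimTree {V : Type u} (G : SimpleGraph V) (p : V → Option V) : Prop where
  exists_root : ∃ r, p r = none ∧ ∀ y, y ∈ subtreeVerts p r
  comparable : ∀ ⦃x y⦄, G.Adj x y → x ∈ subtreeVerts p y ∨ y ∈ subtreeVerts p x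
  child_adj : ∀ ⦃c x⦄, p c = some x → ∃ y ∈ subtreeVerts p c, G.Adj x y

/-! ### Depth functions and antisymmetry of the ancestor relation -/

section Depth

variable {V : Type u} {G : SimpleGraph V} {p : V → Option V}

theorem depth_le {d : V → ℕ}
    (hd : ∀ x y, p x = some y → d x = d y + 1) {x y : V} (h : y ∈ subtreeVerts p x) : d x ≤ d y := by
  induction h using Relation.ReflTransGen.head_induction_on with
  | refl => exact le_rfl
  | head h _ ih => have := hd _ _ h; omega

theorem eq_of_depth_le {d : V → ℕ}
    (hd : ∀ x y, p x = some y → d x = d y + 1) {x y : V} (h : y ∈ subtreeVerts p x) (h' : d y ≤ d x) : y = x := by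
  rcases mem_subtreeVerts_iff.1 h with h | ⟨z, hz, h⟩
  · exact h
  · have := hd _ _ hz
    have := depth_le hd h
    omega

theorem subtreeVerts_antisymm {d : V → ℕ}
    (hd : ∀ x y, p x = some y → d x = d y + 1) {x y : V} (h : y ∈ subtreeVerts p x) (h' : x ∈ subtreeVerts p y) :
    y = x :=
  eq_of_depth_le hd h (depth_le hd h')

theorem notMem_subtreeVerts_child {d : V → ℕ}
    (hd : ∀ x y, p x = some y → d x = d y + 1) {x c : V} (h : p c = some x) : x ∉ subtreeVerts p c := fun h' => by
  have := hd _ _ h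
  have := depth_le hd h'
  omega

end Depth

/-! ### Equivalence of the recursive and nonrecursive descriptions of search trees -/

section Connected

variable {V : Type u} {G : SimpleGraph V} {p : V → Option V}

theorem JoinedInside.of_closed {S K : Set V} {a b : V} (h : JoinedInside G S a b) (ha : a ∈ K)
    (hK : ∀ x y, x ∈ K → x ∈ S → y ∈ S → G.Adj x y → y ∈ K) : JoinedInside G K a b := by
  have : JoinedInside G K a b ∧ b ∈ K := by
    induction h with
    | refl => exact ⟨.refl, ha⟩
    | tail _ h ih =>
      have := hK _ _ ih.2 h.2.1 h.2.2 h.1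
      exact ⟨ih.1.tail ⟨h.1, ih.2, this⟩, this⟩
  exact this.1

theorem JoinedInside.exists_exit {S K : Set V} {a b : V} (h : JoinedInside G S a b) (ha : a ∈ K)
    (hb : b ∉ K) : ∃ x y, x ∈ K ∧ x ∈ S ∧ y ∈ S ∧ y ∉ K ∧ G.Adj x y := by
  by_contra! hcon
  exact hb (h.mem_of_closed ha fun x y hx hxS hyS hxy => by
    by_contra hy
    exact hcon x y hx hxS hyS hy hxy)

theorem preconnectedSet_univ (h : G.Preconnected) : PreconnectedSet G Set.univ := by
  intro a _ b hb
  clear hb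
  have := (SimpleGraph.reachable_iff_reflTransGen a b).1 (h a b)
  induction this with
  | refl => exact .refl
  | tail _ h ih => exact ih.tail ⟨h, trivial, trivial⟩

theorem mem_image_supp_iff {S : Set V} (C : (G.induce S).ConnectedComponent) {x : V} :
    x ∈ Subtype.val '' C.supp ↔ ∃ h : x ∈ S, (G.induce S).connectedComponentMk ⟨x, h⟩ = C := by
  simp [SimpleGraph.ConnectedComponent.mem_supp_iff]

theorem image_supp_subset {S : Set V} (C : (G.induce S).ConnectedComponent) :
    Subtype.val '' C.supp ⊆ S := fun _ hx => ((mem_image_supp_iff C).1 hx).1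

theorem image_supp_closed {S : Set V} (C : (G.induce S).ConnectedComponent) (x y : V)
    (hx : x ∈ Subtype.val '' C.supp) (hy : y ∈ S) (hxy : G.Adj x y) :
    y ∈ Subtype.val '' C.supp := by
  rw [mem_image_supp_iff] at hx ⊢
  obtain ⟨hxS, rfl⟩ := hx
  refine ⟨hy, ?_⟩
  rw [SimpleGraph.ConnectedComponent.eq]
  exact SimpleGraph.Adj.reachable (G := G.induce S) hxy.symm

theorem joinedInside_of_mem_image_supp {S : Set V} (C : (G.induce S).ConnectedComponent) {a b : V}
    (ha : a ∈ Subtype.val '' C.supp) (hb : b ∈ Subtype.val '' C.supp) : JoinedInside G S a b := by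
  obtain ⟨haS, ha'⟩ := (mem_image_supp_iff C).1 ha
  obtain ⟨hbS, hb'⟩ := (mem_image_supp_iff C).1 hb
  rw [← ha', SimpleGraph.ConnectedComponent.eq, reachable_induce_iff] at hb'
  exact hb'.symm

theorem image_supp_preconnectedSet {S : Set V} (C : (G.induce S).ConnectedComponent) :
    PreconnectedSet G (Subtype.val '' C.supp) := fun _ ha _ hb =>
  (joinedInside_of_mem_image_supp C ha hb).of_closed ha
    fun x y hx _ hy => image_supp_closed C x y hx hy

theorem image_supp_nonempty {S : Set V} (C : (G.induce S).ConnectedComponent) :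
    (Subtype.val '' C.supp).Nonempty := C.nonempty_supp.image _

/-- A connected set has a vertex above all the others. -/
theorem IsElimTree.exists_top (h : IsElimTree G p) {S : Set V} (hS : PreconnectedSet G S)
    (hne : S.Nonempty) : ∃ t ∈ S, S ⊆ subtreeVerts p t := by
  obtain ⟨d, hd⟩ := exists_depth h.exists_root
  obtain ⟨t, ht, hmin⟩ := exists_minimalFor_of_wellFoundedLT (· ∈ S) d hne
  refine ⟨t, ht, fun b hb => ?_⟩
  refine (hS t ht b hb).mem_of_closed (mem_subtreeVerts_self p t) fun x y hx _ hyS hxy => ?_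
  rcases h.comparable hxy with h1 | h1
  · rcases subtreeVerts_total hx h1 with h2 | h2
    · have := eq_of_depth_le hd h2 (by
        have := depth_le hd h2
        exact hmin hyS this)
      exact this ▸ mem_subtreeVerts_self p t
    · exact h2
  · exact mem_subtreeVerts_trans h1 hx

theorem IsElimTree.antisymm (h : IsElimTree G p) {x y : V} (h1 : y ∈ subtreeVerts p x)
    (h2 : x ∈ subtreeVerts p y) : y = x := by
  obtain ⟨d, hd⟩ := exists_depth h.exists_root
  exact subtreeVerts_antisymm hd h1 h2

theorem IsElimTree.notMem_child (h : IsElimTree G p) {x c : V} (hc : p c = some x) :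
    x ∉ subtreeVerts p c := by
  obtain ⟨d, hd⟩ := exists_depth h.exists_root
  exact notMem_subtreeVerts_child hd hc

/-- By induction on size: each child's subtree is connected, and `child_adj` attaches it to `x` by
an edge. -/
theorem IsElimTree.preconnectedSet [Finite V] (h : IsElimTree G p) (x : V) :
    PreconnectedSet G (subtreeVerts p x) := by
  induction hn : (subtreeVerts p x).ncard using Nat.strong_induction_on generalizing x with
  | _ n ih =>
    have key : ∀ a ∈ subtreeVerts p x, JoinedInside G (subtreeVerts p x) a x := by
      intro a ha
      rcases mem_subtreeVerts_iff_child.1 ha with rfl | ⟨c, hc, hac⟩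
      · exact .refl
      · have hsub : subtreeVerts p c ⊆ subtreeVerts p x :=
          fun y hy => mem_subtreeVerts_trans hy (mem_subtreeVerts_of_parent hc)
        have hlt : (subtreeVerts p c).ncard < n := hn ▸ Set.ncard_lt_ncard
          ⟨hsub, fun h' => h.notMem_child hc (h' (mem_subtreeVerts_self p x))⟩ (Set.toFinite _)
        obtain ⟨z, hz, hxz⟩ := h.child_adj hc
        exact ((ih _ hlt c rfl a hac z hz).mono hsub).tail
          ⟨hxz.symm, hsub hz, mem_subtreeVerts_self p x⟩
    intro a ha b hb
    exact (key a ha).trans (key b hb).symm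

/-- The components left after deleting `x` are exactly the subtrees of its children: these are
connected, and comparability forbids edges between two of them. -/
theorem IsElimTree.isSearchTreeOn [Finite V] (h : IsElimTree G p) (x : V) :
    IsSearchTreeOn G p (subtreeVerts p x) x := by
  induction hn : (subtreeVerts p x).ncard using Nat.strong_induction_on generalizing x with
  | _ n ih =>
    have key : ∀ C : (G.induce (subtreeVerts p x \ {x})).ConnectedComponent,
        ∃ c, p c = some x ∧ Subtype.val '' C.supp = subtreeVerts p c := by
      intro C
      obtain ⟨a, ha⟩ := image_supp_nonempty C
      have haS := image_supp_subset C ha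
      rcases mem_subtreeVerts_iff_child.1 haS.1 with rfl | ⟨c, hc, hac⟩
      · exact absurd rfl haS.2
      refine ⟨c, hc, Set.Subset.antisymm (fun y hy => ?_) fun y hy => ?_⟩
      · refine (joinedInside_of_mem_image_supp C ha hy).mem_of_closed hac
          fun m k hm _ hk hmk => ?_
        rcases h.comparable hmk with h1 | h1
        · rcases subtreeVerts_total hm h1 with h2 | h2
          · rcases (mem_subtreeVerts_iff_of_parent hc).1 h2 with rfl | h3
            · exact mem_subtreeVerts_self p c
            · exact absurd (h.antisymm hk.1 h3) hk.2
          · exact h2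
        · exact mem_subtreeVerts_trans h1 hm
      · refine (h.preconnectedSet c a hac y hy).mem_of_closed ha fun m k hm hmc hk hmk => ?_
        refine image_supp_closed C m k hm ⟨mem_subtreeVerts_trans hk
          (mem_subtreeVerts_of_parent hc), ?_⟩ hmk
        rintro rfl
        exact h.notMem_child hc hk
    choose child hc hC using key
    refine .intro _ _ (mem_subtreeVerts_self p x) child hc fun C => ?_
    rw [hC]
    refine ih _ (hn ▸ Set.ncard_lt_ncard ⟨fun y hy => mem_subtreeVerts_trans hy
      (mem_subtreeVerts_of_parent (hc C)), fun h' => h.notMem_child (hc C)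
        (h' (mem_subtreeVerts_self p x))⟩ (Set.toFinite _)) _ rfl

/-- Inside `S`, a component of `S - r` can be left only towards `r`; as `S` is connected, `r`
therefore has a neighbour in each component. The recursion does not constrain the parent of `r`,
hence the exclusion `c ≠ r`. -/
theorem IsSearchTreeOn.spec {S : Set V} {r : V} (h : IsSearchTreeOn G p S r)
    (hS : PreconnectedSet G S) :
    (∀ x ∈ S, x ∈ subtreeVerts p r) ∧
    (∀ x ∈ S, ∀ y ∈ S, G.Adj x y → x ∈ subtreeVerts p y ∨ y ∈ subtreeVerts p x) ∧
    (∀ c ∈ S, c ≠ r → ∀ x, p c = some x → ∃ z ∈ subtreeVerts p c, G.Adj x z) := by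
  induction h with
  | intro S r hr child hchild hsub ih =>
    have ih' := fun C => ih C (image_supp_preconnectedSet C)
    have hmk : ∀ x ∈ S, x ≠ r → ∃ C : (G.induce (S \ {r})).ConnectedComponent,
        x ∈ Subtype.val '' C.supp := fun x hx hxr =>
      ⟨(G.induce (S \ {r})).connectedComponentMk ⟨x, hx, hxr⟩,
        (mem_image_supp_iff _).2 ⟨⟨hx, hxr⟩, rfl⟩⟩
    have h1 : ∀ x ∈ S, x ∈ subtreeVerts p r := by
      intro x hx
      by_cases hxr : x = r
      · exact hxr ▸ mem_subtreeVerts_self p r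
      · obtain ⟨C, hC⟩ := hmk x hx hxr
        exact mem_subtreeVerts_trans ((ih' C).1 x hC) (mem_subtreeVerts_of_parent (hchild C))
    refine ⟨h1, fun x hx y hy hxy => ?_, fun c hc hcr x hx => ?_⟩
    · by_cases hxr : x = r
      · exact hxr ▸ Or.inr (h1 y hy)
      by_cases hyr : y = r
      · exact hyr ▸ Or.inl (h1 x hx)
      obtain ⟨C, hC⟩ := hmk x hx hxr
      exact (ih' C).2.1 x hC y (image_supp_closed C x y hC ⟨hy, hyr⟩ hxy) hxy
    · obtain ⟨C, hC⟩ := hmk c hc hcr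
      by_cases hcC : c = child C
      · obtain ⟨a, b, ha, haS, hbS, hb, hab⟩ := (hS c hc r hr).exists_exit hC
          fun h => (image_supp_subset C h).2 rfl
        have hbr : b = r := by
          by_contra hbr
          exact hb (image_supp_closed C a b ha ⟨hbS, hbr⟩ hab)
        obtain rfl : r = x := by simpa [hcC, hchild C] using hx
        subst hbr
        exact ⟨a, hcC ▸ (ih' C).1 a ha, hab.symm⟩
      · exact (ih' C).2.2 c hC hcC x hx

theorem SearchTree.isElimTree (hG : G.Preconnected) (T : SearchTree G) : IsElimTree G T.parent := by
  obtain ⟨r, hr, hT⟩ := T.exists_root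
  obtain ⟨h1, h2, h3⟩ := hT.spec (preconnectedSet_univ hG)
  refine ⟨⟨r, hr, fun y => h1 y trivial⟩, fun x y => h2 x trivial y trivial,
    fun c x hc => h3 c trivial ?_ x hc⟩
  rintro rfl
  simp [hr] at hc

/-- The search tree with a parent function satisfying the nonrecursive description. -/
def IsElimTree.toSearchTree [Finite V] (h : IsElimTree G p) : SearchTree G where
  parent := p
  exists_root := by
    obtain ⟨r, hr, hall⟩ := h.exists_root
    refine ⟨r, hr, ?_⟩
    rw [← Set.eq_univ_of_forall hall]
    exact h.isSearchTreeOn r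

end Connected

/-! ### Effect of a rotation on subtrees -/

section Rotate

variable {V : Type u} {G : SimpleGraph V} {p : V → Option V} {u v : V}

theorem rotate_child : rotate G p u v v = p u := by simp [rotate]

theorem rotate_parent (h : u ≠ v) : rotate G p u v u = some v := by simp [rotate, h]

theorem rotate_of_moved {x : V} (hv : x ≠ v) (hu : x ≠ u) (hx : p x = some v)
    (h : ∃ y ∈ subtreeVerts p x, G.Adj u y) : rotate G p u v x = some u := by
  simp only [rotate, if_neg hv, if_neg hu]
  rw [if_pos ⟨hx, h⟩]

theorem rotate_of_not_moved {x : V} (hv : x ≠ v) (hu : x ≠ u)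
    (h : ¬ (p x = some v ∧ ∃ y ∈ subtreeVerts p x, G.Adj u y)) : rotate G p u v x = p x := by
  simp only [rotate, if_neg hv, if_neg hu]
  rw [if_neg h]

theorem rotate_cases (h : u ≠ v) (x : V) :
    (x = v ∧ rotate G p u v x = p u) ∨ (x = u ∧ rotate G p u v x = some v) ∨
    (x ≠ v ∧ x ≠ u ∧ p x = some v ∧ (∃ y ∈ subtreeVerts p x, G.Adj u y) ∧
      rotate G p u v x = some u) ∨
    (x ≠ v ∧ x ≠ u ∧ ¬ (p x = some v ∧ ∃ y ∈ subtreeVerts p x, G.Adj u y) ∧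
      rotate G p u v x = p x) := by
  by_cases hv : x = v
  · subst hv; exact Or.inl ⟨rfl, rotate_child⟩
  by_cases hu : x = u
  · subst hu; exact Or.inr (Or.inl ⟨rfl, rotate_parent h⟩)
  by_cases hm : p x = some v ∧ ∃ y ∈ subtreeVerts p x, G.Adj u y
  · exact Or.inr (Or.inr (Or.inl ⟨hv, hu, hm.1, hm.2, rotate_of_moved hv hu hm.1 hm.2⟩))
  · exact Or.inr (Or.inr (Or.inr ⟨hv, hu, hm, rotate_of_not_moved hv hu hm⟩))

theorem IsElimTree.ne_of_parent (h : IsElimTree G p) (huv : p v = some u) : u ≠ v := by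
  rintro rfl
  exact h.notMem_child huv (mem_subtreeVerts_self p u)

/-- Doubling the depths leaves room to place `v` strictly between `u` and the former parent of `u`.
This measure makes `mem_subtreeVerts_iff_of_measure` available for the rotated parent function
before it is known to be a search tree. -/
theorem IsElimTree.exists_rotate_measure (h : IsElimTree G p) (huv : p v = some u) :
    ∃ m : V → ℕ, ∀ x y, rotate G p u v x = some y → m y < m x := by
  classical
  obtain ⟨d, hd⟩ := exists_depth h.exists_root
  have hne := h.ne_of_parent huv
  have h0 := hd _ _ huv
  refine ⟨fun x => if x = v then 2 * d u else 2 * d x + 1, fun x y hxy => ?_⟩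
  have hmy : ∀ y, (if y = v then 2 * d u else 2 * d y + 1) ≤ 2 * d y + 1 := fun y => by
    split_ifs with h
    · subst h; omega
    · exact le_rfl
  have := hmy y
  rcases rotate_cases (G := G) (p := p) hne x with ⟨rfl, h1⟩ | ⟨rfl, h1⟩ | ⟨h1, h2, h3, -, h4⟩ |
    ⟨h1, h2, h3, h4⟩
  · rw [h1] at hxy
    have := hd _ _ hxy
    simp only [if_true]
    omega
  · rw [h1] at hxy
    obtain rfl : v = y := by simpa using hxy
    simp [hne]
  · rw [h4] at hxy
    obtain rfl : u = y := by simpa using hxy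
    have := hd _ _ h3
    simp only [if_neg h1]
    omega
  · rw [h4] at hxy
    have := hd _ _ hxy
    simp only [if_neg h1]
    omega

theorem IsElimTree.mem_rotate_child (h : IsElimTree G p) (huv : p v = some u) (y : V) :
    y ∈ subtreeVerts (rotate G p u v) v ↔ y ∈ subtreeVerts p u := by
  obtain ⟨m, hm⟩ := h.exists_rotate_measure huv
  have hne := h.ne_of_parent huv
  refine mem_subtreeVerts_iff_of_measure m hm _ (fun y => ?_) y
  have hu := mem_subtreeVerts_self p u
  have hv := mem_subtreeVerts_of_parent huv
  rcases rotate_cases (G := G) (p := p) hne y with ⟨rfl, h1⟩ | ⟨rfl, h1⟩ | ⟨h1, h2, h3, -, h4⟩ |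
    ⟨h1, h2, h3, h4⟩
  · simp [hv]
  · simp [h1, hu, hv]
  · simp [h4, hu, mem_subtreeVerts_trans (mem_subtreeVerts_of_parent h3) hv]
  · rw [h4, mem_subtreeVerts_iff]; simp [h1, h2]

theorem IsElimTree.mem_rotate_other (h : IsElimTree G p) (huv : p v = some u) {x : V} (hxu : x ≠ u)
    (hxv : x ≠ v) (y : V) :
    y ∈ subtreeVerts (rotate G p u v) x ↔ y ∈ subtreeVerts p x := by
  obtain ⟨m, hm⟩ := h.exists_rotate_measure huv
  have hne := h.ne_of_parent huv
  refine mem_subtreeVerts_iff_of_measure m hm _ (fun y => ?_) y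
  have hvu : v ∈ subtreeVerts p x ↔ u ∈ subtreeVerts p x := by
    rw [mem_subtreeVerts_iff_of_parent huv]; simp [hxv.symm]
  rcases rotate_cases (G := G) (p := p) hne y with ⟨rfl, h1⟩ | ⟨rfl, h1⟩ | ⟨h1, h2, h3, -, h4⟩ |
    ⟨h1, h2, h3, h4⟩
  · rw [h1, hvu, mem_subtreeVerts_iff]; simp [hxu.symm, hxv.symm]
  · rw [h1, ← hvu]; simp [hxu.symm]
  · rw [h4, mem_subtreeVerts_iff_of_parent h3, hvu]; simp
  · rw [h4, mem_subtreeVerts_iff]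

theorem IsElimTree.mem_rotate_parent (h : IsElimTree G p) (huv : p v = some u) (y : V) :
    y ∈ subtreeVerts (rotate G p u v) u ↔ (y ∈ subtreeVerts p u ∧ y ∉ subtreeVerts p v) ∨
      ∃ c, p c = some v ∧ (∃ z ∈ subtreeVerts p c, G.Adj u z) ∧ y ∈ subtreeVerts p c := by
  obtain ⟨m, hm⟩ := h.exists_rotate_measure huv
  have hne := h.ne_of_parent huv
  refine mem_subtreeVerts_iff_of_measure m hm (fun y => (y ∈ subtreeVerts p u ∧ y ∉ subtreeVerts p v) ∨
    ∃ c, p c = some v ∧ (∃ z ∈ subtreeVerts p c, G.Adj u z) ∧ y ∈ subtreeVerts p c) (fun y => ?_) y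
  have hu := mem_subtreeVerts_self p u
  have hv := mem_subtreeVerts_self p v
  have huv' := h.notMem_child huv
  have hFv : ¬ ((v ∈ subtreeVerts p u ∧ v ∉ subtreeVerts p v) ∨
      ∃ c, p c = some v ∧ (∃ z ∈ subtreeVerts p c, G.Adj u z) ∧ v ∈ subtreeVerts p c) := by
    rintro (⟨-, h1⟩ | ⟨c, hc, -, h1⟩)
    · exact h1 hv
    · exact h.notMem_child hc h1
  rcases rotate_cases (G := G) (p := p) hne y with ⟨rfl, h1⟩ | ⟨rfl, h1⟩ | ⟨h1, h2, h3, h3', h4⟩ |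
    ⟨h1, h2, h3, h4⟩
  · rw [h1]
    refine iff_of_false hFv ?_
    rintro (h2 | ⟨z, hz, ⟨h2, -⟩ | ⟨c, hc, -, h2⟩⟩)
    · exact hne h2.symm
    · exact h.notMem_child hz h2
    · exact h.notMem_child hz (mem_subtreeVerts_trans h2 (mem_subtreeVerts_trans
        (mem_subtreeVerts_of_parent hc) (mem_subtreeVerts_of_parent huv)))
  · exact iff_of_true (Or.inl ⟨hu, huv'⟩) (Or.inl rfl)
  · exact iff_of_true (Or.inr ⟨y, h3, h3', mem_subtreeVerts_self p y⟩)
      (Or.inr ⟨u, h4, Or.inl ⟨hu, huv'⟩⟩)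
  · rw [h4]
    simp only [h2, false_or]
    constructor
    · rintro (⟨h5, h6⟩ | ⟨c, hc, hN, h5⟩)
      · obtain ⟨z, hz, hzu⟩ := (mem_subtreeVerts_iff.1 h5).resolve_left h2
        exact ⟨z, hz, Or.inl ⟨hzu, fun h7 =>
          h6 (mem_subtreeVerts_trans (mem_subtreeVerts_of_parent hz) h7)⟩⟩
      · rcases mem_subtreeVerts_iff.1 h5 with rfl | ⟨z, hz, hzc⟩
        · exact absurd ⟨hc, hN⟩ h3
        · exact ⟨z, hz, Or.inr ⟨c, hc, hN, hzc⟩⟩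
    · rintro ⟨z, hz, ⟨h5, h6⟩ | ⟨c, hc, hN, h5⟩⟩
      · refine Or.inl ⟨mem_subtreeVerts_trans (mem_subtreeVerts_of_parent hz) h5, fun h7 => ?_⟩
        exact h6 (((mem_subtreeVerts_iff_of_parent hz).1 h7).resolve_left h1)
      · exact Or.inr ⟨c, hc, hN, mem_subtreeVerts_trans (mem_subtreeVerts_of_parent hz) h5⟩

theorem IsElimTree.mem_rotate_parent_subset (h : IsElimTree G p) (huv : p v = some u) {y : V}
    (hy : y ∈ subtreeVerts (rotate G p u v) u) : y ∈ subtreeVerts p u ∧ y ≠ v := by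
  rcases (h.mem_rotate_parent huv y).1 hy with ⟨h1, h2⟩ | ⟨c, hc, -, h1⟩
  · exact ⟨h1, fun h3 => h2 (h3 ▸ mem_subtreeVerts_self p y)⟩
  · refine ⟨mem_subtreeVerts_trans h1 (mem_subtreeVerts_trans
      (mem_subtreeVerts_of_parent hc) (mem_subtreeVerts_of_parent huv)), ?_⟩
    rintro rfl
    exact h.notMem_child hc h1

/-- Rotations preserve search trees. -/
theorem IsElimTree.isElimTree_rotate (h : IsElimTree G p) (huv : p v = some u) :
    IsElimTree G (rotate G p u v) := by
  have hne := h.ne_of_parent huv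
  have hvu := mem_subtreeVerts_of_parent huv
  refine ⟨?_, ?_, ?_⟩
  · obtain ⟨r, hr, hall⟩ := h.exists_root
    by_cases hur : u = r
    · subst hur
      exact ⟨v, by rw [rotate_child, hr], fun y => (h.mem_rotate_child huv y).2 (hall y)⟩
    · have hrv : r ≠ v := by
        rintro rfl
        simp [hr] at huv
      refine ⟨r, ?_, fun y => (h.mem_rotate_other huv (Ne.symm hur) hrv y).2 (hall y)⟩
      rw [rotate_of_not_moved hrv (Ne.symm hur) (by simp [hr]), hr]
  · have key : ∀ x y, G.Adj x y → x ∈ subtreeVerts p y →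
        x ∈ subtreeVerts (rotate G p u v) y ∨ y ∈ subtreeVerts (rotate G p u v) x := by
      intro x y hxy hx
      by_cases hyv : y = v
      · subst hyv
        exact Or.inl ((h.mem_rotate_child huv x).2 (mem_subtreeVerts_trans hx hvu))
      by_cases hyu : y = u
      · subst hyu
        by_cases hxv : x = v
        · subst hxv
          exact Or.inr ((h.mem_rotate_child huv y).2 (mem_subtreeVerts_self p y))
        refine Or.inl ((h.mem_rotate_parent huv x).2 ?_)
        by_cases hx' : x ∈ subtreeVerts p v
        · obtain ⟨c, hc, hxc⟩ := (mem_subtreeVerts_iff_child.1 hx').resolve_left hxv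
          exact Or.inr ⟨c, hc, ⟨x, hxc, hxy.symm⟩, hxc⟩
        · exact Or.inl ⟨hx, hx'⟩
      · exact Or.inl ((h.mem_rotate_other huv hyu hyv x).2 hx)
    intro x y hxy
    rcases h.comparable hxy with h1 | h1
    · exact key x y hxy h1
    · exact (key y x hxy.symm h1).symm
  · intro c x hcx
    rcases rotate_cases (G := G) (p := p) hne c with ⟨rfl, h1⟩ | ⟨rfl, h1⟩ |
      ⟨h1, h2, h3, ⟨z, hz, hzu⟩, h4⟩ | ⟨h1, h2, h3, h4⟩
    · obtain ⟨z, hz, hxz⟩ := h.child_adj (h1 ▸ hcx)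
      exact ⟨z, (h.mem_rotate_child huv z).2 hz, hxz⟩
    · obtain rfl : v = x := by simpa [h1] using hcx
      -- The old subtree of `v` contains a neighbour `y` of the demoted vertex. Either `y` is `v`,
      -- or `y` lies below a child `b` of `v`; then the subtree of `b` is moved, and it brings along
      -- a neighbour of `v`.
      obtain ⟨y, hy, hcy⟩ := h.child_adj huv
      rcases mem_subtreeVerts_iff_child.1 hy with rfl | ⟨b, hb, hyb⟩
      · exact ⟨c, mem_subtreeVerts_self _ c, hcy.symm⟩
      · obtain ⟨z, hz, hvz⟩ := h.child_adj hb
        exact ⟨z, (h.mem_rotate_parent huv z).2 (Or.inr ⟨b, hb, ⟨y, hyb, hcy⟩, hz⟩), hvz⟩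
    · obtain rfl : u = x := by simpa [h4] using hcx
      exact ⟨z, (h.mem_rotate_other huv h2 h1 z).2 hz, hzu⟩
    · obtain ⟨z, hz, hxz⟩ := h.child_adj (h4 ▸ hcx)
      exact ⟨z, (h.mem_rotate_other huv h2 h1 z).2 hz, hxz⟩

end Rotate

/-! ### Rotation distance and reversed pairs -/

section Distance

variable {V : Type u} {G : SimpleGraph V} {p q : V → Option V}

/-- The pairs `(x, y)` with `x` strictly above `y` in `p` but strictly below `y` in `q`. -/
def reversedPairs (p q : V → Option V) : Set (V × V) :=
  {a | a.2 ∈ subtreeVerts p a.1 ∧ a.1 ∈ subtreeVerts q a.2 ∧ a.1 ≠ a.2}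

/-- The parent is the lowest proper ancestor, so the ancestor relation determines it. -/
theorem IsElimTree.eq_of_subtreeVerts_eq (hp : IsElimTree G p) (hq : IsElimTree G q)
    (h : ∀ x, subtreeVerts p x = subtreeVerts q x) : p = q := by
  have key : ∀ {p q : V → Option V}, IsElimTree G p → IsElimTree G q →
      (∀ x, subtreeVerts p x = subtreeVerts q x) → ∀ y z, p y = some z → q y = some z := by
    intro p q hp hq h y z hyz
    have h1 : y ∈ subtreeVerts q z := h z ▸ mem_subtreeVerts_of_parent hyz
    obtain ⟨z', hz', hz'z⟩ := (mem_subtreeVerts_iff.1 h1).resolve_left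
      (hp.ne_of_parent hyz).symm
    have h2 : y ∈ subtreeVerts p z' := h z' ▸ mem_subtreeVerts_of_parent hz'
    have h3 := ((mem_subtreeVerts_iff_of_parent hyz).1 h2).resolve_left
      (hq.ne_of_parent hz').symm
    rw [hz', hp.antisymm (h z ▸ hz'z) h3]
  funext y
  exact Option.ext fun z => ⟨key hp hq h y z, key hq hp (fun x => (h x).symm) y z⟩

/-- The subtree of `x` in one tree is connected, so it has a top in the other; a top different from
`x` would form a reversed pair with `x`. -/
theorem IsElimTree.eq_of_reversedPairs_eq_empty [Finite V] (hp : IsElimTree G p)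
    (hq : IsElimTree G q) (h : reversedPairs p q = ∅) : p = q := by
  have hno : ∀ x y, y ∈ subtreeVerts p x → x ∈ subtreeVerts q y → x = y := fun x y h1 h2 => by
    by_contra h3
    exact (Set.eq_empty_iff_forall_notMem.1 h (x, y)) ⟨h1, h2, h3⟩
  refine hp.eq_of_subtreeVerts_eq hq fun x => Set.Subset.antisymm ?_ ?_
  · obtain ⟨t, ht, hsub⟩ := hq.exists_top (hp.preconnectedSet x) ⟨x, mem_subtreeVerts_self p x⟩
    rw [← hno x t ht (hsub (mem_subtreeVerts_self p x))] at hsub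
    exact hsub
  · obtain ⟨t, ht, hsub⟩ := hp.exists_top (hq.preconnectedSet x) ⟨x, mem_subtreeVerts_self q x⟩
    rw [hno t x (hsub (mem_subtreeVerts_self q x)) ht] at hsub
    exact hsub

/-- Choose a reversed pair whose lower vertex `v` is as high as possible in `q`, and let `u` be the
parent of `v` in `p`. The maximality of `v`, applied to the `q`-top of the `p`-subtree of `u`, shows
that `u` is below `v` in `q`; so the rotation undoes the pair `(u, v)`. Only the subtree of `v`
grows, and a new pair `(v, b)` would come from a reversed pair `(u, b)` with `b` above `v` in `q`,
against the choice of `v`. -/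
theorem IsElimTree.exists_rotate_reversedPairs [Finite V] (hp : IsElimTree G p)
    (hq : IsElimTree G q) (h : (reversedPairs p q).Nonempty) :
    ∃ u v, p v = some u ∧ reversedPairs (rotate G p u v) q ⊂ reversedPairs p q := by
  obtain ⟨d, hd⟩ := exists_depth hq.exists_root
  obtain ⟨⟨x, v⟩, ⟨hvx, hxv, hne⟩, hmin⟩ :=
    exists_minimalFor_of_wellFoundedLT (· ∈ reversedPairs p q) (fun a => d a.2) h
  dsimp only at hvx hxv hne
  have hmin' : ∀ a b, b ∈ subtreeVerts p a → a ∈ subtreeVerts q b → a ≠ b →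
      v ∈ subtreeVerts q b → v = b := fun a b h1 h2 h3 h4 =>
    eq_of_depth_le hd h4 (hmin (j := (a, b)) ⟨h1, h2, h3⟩ (depth_le hd h4))
  obtain ⟨u, huv, hux⟩ := (mem_subtreeVerts_iff.1 hvx).resolve_left hne.symm
  have huq : u ∈ subtreeVerts q v := by
    obtain ⟨t, ht, hsub⟩ := hq.exists_top (hp.preconnectedSet u) ⟨u, mem_subtreeVerts_self p u⟩
    have hvt := hsub (mem_subtreeVerts_of_parent huv)
    by_cases htu : u = t
    · subst htu
      by_cases hxu : x = u
      · exact hxu ▸ hxv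
      · exact absurd (hmin' x u hux (mem_subtreeVerts_trans hxv hvt) hxu hvt).symm
          (hp.ne_of_parent huv)
    · rw [hmin' u t ht (hsub (mem_subtreeVerts_self p u)) htu hvt]
      exact hsub (mem_subtreeVerts_self p u)
  have hne' := hp.ne_of_parent huv
  refine ⟨u, v, huv, ⟨?_, fun hcon => ?_⟩⟩
  · rintro ⟨a, b⟩ ⟨h1, h2, h3⟩
    dsimp only at h1 h2 h3
    by_cases hau : a = u
    · subst hau
      exact ⟨(hp.mem_rotate_parent_subset huv h1).1, h2, h3⟩
    by_cases hav : a = v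
    · subst hav
      rw [hp.mem_rotate_child huv] at h1
      have hub := mem_subtreeVerts_trans huq h2
      by_cases hub' : u = b
      · subst hub'
        exact absurd (hq.antisymm huq h2) hne'
      · exact absurd (hmin' u b h1 hub hub' h2) h3
    · exact ⟨(hp.mem_rotate_other huv hau hav b).1 h1, h2, h3⟩
  · have := hcon (a := (u, v)) ⟨mem_subtreeVerts_of_parent huv, huq, hne'⟩
    exact (hp.mem_rotate_parent_subset huv this.1).2 rfl

theorem rotationGraph_adj_of_rotate {T T' : SearchTree G} (hT : IsElimTree G T.parent) {u v : V}
    (huv : T.parent v = some u) (h : T'.parent = rotate G T.parent u v) :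
    (rotationGraph G).Adj T T' := by
  rw [rotationGraph, SimpleGraph.fromRel_adj]
  refine ⟨?_, Or.inl ⟨u, v, huv, h⟩⟩
  rintro rfl
  have := rotate_child (G := G) (p := T.parent) (u := u) (v := v)
  rw [← h, huv] at this
  exact hT.ne_of_parent this.symm rfl

/-- The rotation distance is at most the number of reversed pairs. -/
theorem edist_le_reversedPairs [Finite V] (hG : G.Preconnected) (T T' : SearchTree G) :
    (rotationGraph G).edist T T' ≤ (reversedPairs T.parent T'.parent).ncard := by
  induction hn : (reversedPairs T.parent T'.parent).ncard using Nat.strong_induction_on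
    generalizing T with
  | _ n ih =>
    have hT := T.isElimTree hG
    have hT' := T'.isElimTree hG
    rcases (reversedPairs T.parent T'.parent).eq_empty_or_nonempty with h | h
    · rw [SearchTree.ext (hT.eq_of_reversedPairs_eq_empty hT' h)]
      simp
    · obtain ⟨u, v, huv, hlt⟩ := hT.exists_rotate_reversedPairs hT' h
      have hlt' := hn ▸ Set.ncard_lt_ncard hlt (Set.toFinite _)
      have hadj := rotationGraph_adj_of_rotate (T' := (hT.isElimTree_rotate huv).toSearchTree) hT huv rfl
      calc (rotationGraph G).edist T T' ≤ (rotationGraph G).edist T (hT.isElimTree_rotate huv).toSearchTree +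
            (rotationGraph G).edist (hT.isElimTree_rotate huv).toSearchTree T' :=
              SimpleGraph.edist_triangle
        _ ≤ 1 + ((reversedPairs (rotate G T.parent u v) T'.parent).ncard : ℕ∞) := by
              gcongr
              · exact (SimpleGraph.edist_eq_one_iff_adj.2 hadj).le
              · exact ih _ hlt' _ rfl
        _ ≤ n := by
              norm_cast
              omega

/-- If all vertices of `q` lie at most `K` levels below the root, then there are at most `K`
reversed pairs per vertex. -/
theorem ncard_reversedPairs_le [Fintype V] {d : V → ℕ}
    (hd : ∀ x y, q x = some y → d x = d y + 1) {r : V} (hr : ∀ x, x ∈ subtreeVerts q r) {K : ℕ}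
    (hK : ∀ x, d x - d r ≤ K) : (reversedPairs p q).ncard ≤ Fintype.card V * K := by
  classical
  have hsub : reversedPairs p q ⊆ ⋃ x ∈ (Finset.univ : Finset V),
      Prod.mk x '' {y | x ∈ subtreeVerts q y ∧ y ≠ x} := by
    rintro ⟨x, y⟩ ⟨-, h2, h3⟩
    simpa using ⟨h2, Ne.symm h3⟩
  refine (Set.ncard_le_ncard hsub (Set.toFinite _)).trans ((Finset.set_ncard_biUnion_le _ _).trans
    ((Finset.sum_le_card_nsmul _ _ K fun x _ => ?_).trans_eq (by simp)))
  refine (Set.ncard_image_le (Set.toFinite _)).trans (le_trans ?_ (hK x))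
  have : d '' {y | x ∈ subtreeVerts q y ∧ y ≠ x} ⊆ Set.Ico (d r) (d x) := by
    rintro _ ⟨y, ⟨h1, h2⟩, rfl⟩
    refine ⟨depth_le hd (hr y), lt_of_not_ge fun h3 => h2 ?_⟩
    exact (eq_of_depth_le hd h1 h3).symm
  rw [← Set.InjOn.ncard_image (f := d)]
  · simpa [Set.ncard_eq_toFinset_card'] using Set.ncard_le_ncard this (Set.toFinite _)
  · rintro y ⟨hy, -⟩ z ⟨hz, -⟩ hyz
    rcases subtreeVerts_total hy hz with h | h
    · exact eq_of_depth_le hd h hyz.le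
    · exact (eq_of_depth_le hd h hyz.ge).symm

end Distance

/-! ### Centroids, balanced search trees, and the upper bound -/

section Centroid

variable {V : Type u} {G : SimpleGraph V}

/-- The parent of the root plays no role, so a search tree on a component stays one when its root is
hung below a new vertex. -/
theorem IsSearchTreeOn.congr {p p' : V → Option V} {S : Set V} {r : V}
    (h : IsSearchTreeOn G p S r) (hp : ∀ x ∈ S, x ≠ r → p x = p' x) :
    IsSearchTreeOn G p' S r := by
  induction h with
  | intro S r hr child hchild hsub ih =>
    have hmem : ∀ C, child C ∈ Subtype.val '' C.supp := fun C => by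
      cases hsub C with
      | intro _ _ h _ _ _ => exact h
    refine .intro S r hr child (fun C => ?_) fun C => ih C fun x hx _ => ?_
    · have := image_supp_subset C (hmem C)
      rw [← hp _ this.1 this.2, hchild]
    · have := image_supp_subset C hx
      exact hp x this.1 this.2

theorem IsSearchTreeOn.root_mem' {p : V → Option V} {S : Set V} {r : V}
    (h : IsSearchTreeOn G p S r) : r ∈ S := by
  cases h with
  | intro _ _ h _ _ _ => exact h

/-- If every connected set has a vertex splitting it into parts of at most half its size, then
there are search trees in which the sizes of the subtrees are halved at every step. -/
theorem exists_balanced_isSearchTreeOn [Finite V]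
    (hG : ∀ S : Set V, S.Nonempty → PreconnectedSet G S → ∃ r ∈ S, ∀ K ⊆ S \ {r},
      PreconnectedSet G K → 2 * K.ncard ≤ S.ncard) (S : Set V) (hS : S.Nonempty)
    (hSc : PreconnectedSet G S) :
    ∃ (p : V → Option V) (r : V), p r = none ∧ IsSearchTreeOn G p S r ∧
      ∀ d : V → ℕ, (∀ x ∈ S, x ≠ r → ∀ y, p x = some y → d x = d y + 1) →
        ∀ x ∈ S, 2 ^ d x ≤ S.ncard * 2 ^ d r := by
  classical
  induction hn : S.ncard using Nat.strong_induction_on generalizing S with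
  | _ n ih =>
    subst hn
    obtain ⟨r, hr, hhalf⟩ := hG S hS hSc
    have hlt : ∀ C : (G.induce (S \ {r})).ConnectedComponent,
        (Subtype.val '' C.supp).ncard < S.ncard := fun C =>
      Set.ncard_lt_ncard ⟨(image_supp_subset C).trans Set.sdiff_subset,
        fun h => (image_supp_subset C (h hr)).2 rfl⟩ (Set.toFinite _)
    choose pC rC hnone hC hdepth using fun C : (G.induce (S \ {r})).ConnectedComponent =>
      ih _ (hlt C) _ (image_supp_nonempty C) (image_supp_preconnectedSet C) rfl
    let p : V → Option V := fun x =>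
      if h : x ∈ S \ {r} then
        if x = rC ((G.induce (S \ {r})).connectedComponentMk ⟨x, h⟩) then some r
        else pC ((G.induce (S \ {r})).connectedComponentMk ⟨x, h⟩) x
      else none
    have hp : ∀ C, ∀ x ∈ Subtype.val '' C.supp, p x = if x = rC C then some r else pC C x := by
      intro C x hx
      obtain ⟨h, rfl⟩ := (mem_image_supp_iff C).1 hx
      simp only [p, dif_pos h]
    have hpr : ∀ C, p (rC C) = some r := fun C => by simp [hp C _ (hC C).root_mem']
    have hpC : ∀ C, ∀ x ∈ Subtype.val '' C.supp, x ≠ rC C → pC C x = p x := fun C x hx hne => by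
      simp [hp C x hx, hne]
    refine ⟨p, r, by simp [p], .intro S r hr rC hpr fun C => (hC C).congr (hpC C), ?_⟩
    intro d hd x hx
    by_cases hxr : x = r
    · subst hxr
      exact Nat.le_mul_of_pos_left _ ((Set.ncard_pos (Set.toFinite _)).2 hS)
    · have hxC : x ∈ Subtype.val ''
          ((G.induce (S \ {r})).connectedComponentMk ⟨x, hx, hxr⟩).supp :=
        (mem_image_supp_iff _).2 ⟨⟨hx, hxr⟩, rfl⟩
      generalize (G.induce (S \ {r})).connectedComponentMk ⟨x, hx, hxr⟩ = C at hxC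
      -- The bound is claimed for every function dropping by one along parents, so the depth of the
      -- glued tree may be used on each component. The extra level from `rC C` to `r` costs a factor
      -- two, which the halving of the size pays for.
      have h1 := hdepth C d (fun y hy hne z hz => by
        have := image_supp_subset C hy
        exact hd y this.1 this.2 z (hpC C y hy hne ▸ hz)) x hxC
      have h2 := image_supp_subset C (hC C).root_mem'
      rw [hd _ h2.1 h2.2 r (hpr C), pow_succ] at h1
      calc 2 ^ d x ≤ _ := h1
        _ = 2 * (Subtype.val '' C.supp).ncard * 2 ^ d r := by ring
        _ ≤ _ := Nat.mul_le_mul_right _ (hhalf _ (image_supp_subset C)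
          (image_supp_preconnectedSet C))

/-- In an acyclic graph a vertex has at most one neighbour in a connected set avoiding it. -/
theorem SimpleGraph.IsAcyclic.eq_of_adj_preconnectedSet (hG : G.IsAcyclic) {K : Set V}
    (hK : PreconnectedSet G K) {r a b : V} (hr : r ∉ K) (ha : a ∈ K) (hb : b ∈ K)
    (hra : G.Adj r a) (hrb : G.Adj r b) : a = b := by
  by_contra hab
  -- The edge `ra` is a bridge, but the edge `rb` followed by a walk from `b` to `a` inside `K`
  -- would bypass it.
  have h1 := SimpleGraph.isAcyclic_iff_forall_adj_isBridge.1 hG hra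
  rw [SimpleGraph.isBridge_iff] at h1
  refine h1 ?_
  have hrb' : (G \ SimpleGraph.fromEdgeSet {s(r, a)}).Adj r b := by
    simp [hrb, Ne.symm hab, hrb.ne, hra.ne]
  refine hrb'.reachable.trans ?_
  have h2 := hK b hb a ha
  have key : ∀ c, JoinedInside G K b c →
      (G \ SimpleGraph.fromEdgeSet {s(r, a)}).Reachable b c := by
    intro c hc
    induction hc with
    | refl => rfl
    | @tail x y _ h ih =>
      refine ih.trans (SimpleGraph.Adj.reachable ?_)
      have hx : x ≠ r := fun h' => hr (h' ▸ h.2.1)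
      have hy : y ≠ r := fun h' => hr (h' ▸ h.2.2)
      simp [h.1, hx, hy]
  exact key a h2

/-- Connected sets in forests have centroids. -/
theorem SimpleGraph.IsAcyclic.exists_centroid [Finite V] (hG : G.IsAcyclic) (S : Set V)
    (hS : S.Nonempty) (hSc : PreconnectedSet G S) : ∃ r ∈ S, ∀ K ⊆ S \ {r},
      PreconnectedSet G K → 2 * K.ncard ≤ S.ncard := by
  by_contra! hcon
  have key : ∀ r ∈ S, ∃ C : (G.induce (S \ {r})).ConnectedComponent,
      S.ncard < 2 * (Subtype.val '' C.supp).ncard := by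
    intro r hr
    obtain ⟨K, hKS, hK, hlt⟩ := hcon r hr
    have hne : K.Nonempty := by
      rw [Set.nonempty_iff_ne_empty]
      rintro rfl
      simp at hlt
    obtain ⟨a, ha⟩ := hne
    refine ⟨(G.induce (S \ {r})).connectedComponentMk ⟨a, hKS ha⟩, hlt.trans_le ?_⟩
    refine Nat.mul_le_mul_left _ (Set.ncard_le_ncard (fun b hb => ?_) (Set.toFinite _))
    exact (hK a ha b hb).mem_of_closed ((mem_image_supp_iff _).2 ⟨hKS ha, rfl⟩)
      fun x y hx _ hy hxy => image_supp_closed _ x y hx (hKS hy) hxy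
  have hex : ∃ n, ∃ r ∈ S, ∃ C : (G.induce (S \ {r})).ConnectedComponent,
      S.ncard < 2 * (Subtype.val '' C.supp).ncard ∧ (Subtype.val '' C.supp).ncard = n := by
    obtain ⟨r, hr⟩ := hS
    obtain ⟨C, hC⟩ := key r hr
    exact ⟨_, r, hr, C, hC, rfl⟩
  classical
  -- Among all components containing more than half of `S` after the removal of one vertex, take a
  -- smallest one, `C`. Let `r'` be the neighbour in `C` of the removed vertex, and `C'` a heavy
  -- component after removing `r'`. Two heavy sets cannot be disjoint, and `C' ⊆ C` contradicts
  -- minimality. Otherwise `C'` leaves `C` through an edge to the removed vertex, which by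
  -- acyclicity starts at `r'`, although `r' ∉ C'`.
  obtain ⟨r, hr, C, hC, hCn⟩ := Nat.find_spec hex
  have hout : ∀ x y, x ∈ Subtype.val '' C.supp → y ∈ S → y ∉ Subtype.val '' C.supp →
      G.Adj x y → y = r := by
    intro x y hx hyS hy hxy
    by_contra hyr
    exact hy (image_supp_closed C x y hx ⟨hyS, hyr⟩ hxy)
  obtain ⟨a, ha⟩ := image_supp_nonempty C
  have haS := image_supp_subset C ha
  have hrC : r ∉ Subtype.val '' C.supp := fun h => (image_supp_subset C h).2 rfl
  obtain ⟨r', y, hr', hr'S, hyS, hy, hr'y⟩ := (hSc a haS.1 r hr).exists_exit ha hrC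
  obtain rfl := hout r' y hr' hyS hy hr'y
  obtain ⟨C', hC'⟩ := key r' hr'S
  have hr'C' : r' ∉ Subtype.val '' C'.supp := fun h => (image_supp_subset C' h).2 rfl
  have hsub : Subtype.val '' C'.supp ⊆ S := (image_supp_subset C').trans Set.sdiff_subset
  by_cases hdisj : Disjoint (Subtype.val '' C'.supp) (Subtype.val '' C.supp)
  · have h1 := Set.ncard_le_ncard (Set.union_subset hsub
      ((image_supp_subset C).trans Set.sdiff_subset)) (Set.toFinite _)
    rw [Set.ncard_union_eq hdisj (Set.toFinite _) (Set.toFinite _)] at h1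
    omega
  obtain ⟨e, he', he⟩ := Set.not_disjoint_iff.1 hdisj
  by_cases hle : Subtype.val '' C'.supp ⊆ Subtype.val '' C.supp
  · have h1 := Set.ncard_lt_ncard ⟨hle, fun h => hr'C' (h hr')⟩ (Set.toFinite _)
    exact Nat.find_min hex (hCn ▸ h1) ⟨r', hr'S, C', hC', rfl⟩
  · obtain ⟨f, hf', hf⟩ := Set.not_subset.1 hle
    obtain ⟨b, z, hb, hb', hz', hz, hbz⟩ :=
      (image_supp_preconnectedSet C' e he' f hf').exists_exit he hf
    obtain rfl := hout b z hb (hsub hz') hz hbz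
    have := hG.eq_of_adj_preconnectedSet (image_supp_preconnectedSet C) hrC hb hr' hbz.symm
      hr'y.symm
    exact hr'C' (this ▸ hb')

/-- The rotation graph of a tree has diameter at most `2 n log₂ n`. -/
theorem ediam_rotationGraph_le [Fintype V] (hG : G.IsTree) :
    (rotationGraph G).ediam ≤ (2 * (Fintype.card V * Nat.log 2 (Fintype.card V)) : ℕ) := by
  have := hG.connected.nonempty
  have hpre := hG.connected.preconnected
  obtain ⟨p, r, hr, hp, hdepth⟩ := exists_balanced_isSearchTreeOn hG.isAcyclic.exists_centroid
    Set.univ Set.univ_nonempty (preconnectedSet_univ hpre)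
  let T₀ : SearchTree G := ⟨p, r, hr, hp⟩
  have hT₀ : IsElimTree G p := T₀.isElimTree hpre
  obtain ⟨d, hd⟩ := exists_depth hT₀.exists_root
  have hall : ∀ x, x ∈ subtreeVerts p r := fun x =>
    (hp.spec (preconnectedSet_univ hpre)).1 x trivial
  have hlog : ∀ x, d x - d r ≤ Nat.log 2 (Fintype.card V) := by
    intro x
    have h1 := hdepth d (fun x _ _ y => hd x y) x trivial
    refine Nat.le_log_of_pow_le one_lt_two ?_
    rw [Set.ncard_univ, Nat.card_eq_fintype_card] at h1
    refine Nat.le_of_mul_le_mul_right ?_ (pow_pos two_pos (d r))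
    rwa [← pow_add, Nat.sub_add_cancel (depth_le hd (hall x))]
  have hdist : ∀ T, (rotationGraph G).edist T T₀ ≤
      (Fintype.card V * Nat.log 2 (Fintype.card V) : ℕ) := fun T =>
    (edist_le_reversedPairs hpre T T₀).trans
      (by exact_mod_cast ncard_reversedPairs_le hd hall hlog)
  refine SimpleGraph.ediam_le_of_edist_le fun T T' => ?_
  calc (rotationGraph G).edist T T' ≤ (rotationGraph G).edist T T₀ +
        (rotationGraph G).edist T₀ T' := SimpleGraph.edist_triangle
    _ ≤ (Fintype.card V * Nat.log 2 (Fintype.card V) : ℕ) +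
        (Fintype.card V * Nat.log 2 (Fintype.card V) : ℕ) :=
          add_le_add (hdist T) (SimpleGraph.edist_comm (G := rotationGraph G) ▸ hdist T')
    _ = _ := by push_cast; ring

end Centroid

/-! ### Paths to the root and their change under a rotation -/

section RootPath

variable {V : Type u} {G : SimpleGraph V} {p : V → Option V} {u v : V}

/-- `RootPath p o l`: the list `l` consists of the vertices met on the way from `o` to the root. -/
inductive RootPath (p : V → Option V) : Option V → List V → Prop
  | nil : RootPath p none []
  | cons (x : V) (l : List V) (h : RootPath p (p x) l) : RootPath p (some x) (x :: l)

theorem RootPath.unique {o : Option V} {l l' : List V} (h : RootPath p o l) (h' : RootPath p o l') :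
    l = l' := by
  induction h generalizing l' with
  | nil => cases h'; rfl
  | cons x l _ ih =>
    cases h' with
    | cons _ _ h' => rw [ih h']

theorem RootPath.mem_subtreeVerts {o : Option V} {l : List V} (h : RootPath p o l) {x y : V}
    (hx : o = some x) (hy : y ∈ l) : x ∈ subtreeVerts p y := by
  induction h generalizing x with
  | nil => simp at hy
  | cons z l h ih =>
    obtain rfl : z = x := by simpa using hx
    rcases List.mem_cons.1 hy with rfl | hy
    · exact mem_subtreeVerts_self p y
    · cases hz : p z with
      | none =>
        rw [hz] at h
        cases h
        simp at hy
      | some c => exact mem_subtreeVerts_trans (mem_subtreeVerts_of_parent hz) (ih hz hy)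

theorem IsElimTree.exists_rootPath (h : IsElimTree G p) (o : Option V) : ∃ l, RootPath p o l := by
  obtain ⟨r, hr, hall⟩ := h.exists_root
  cases o with
  | none => exact ⟨[], .nil⟩
  | some x =>
    refine Relation.ReflTransGen.head_induction_on (hall x) ⟨[r], .cons _ _ (hr ▸ .nil)⟩ ?_
    rintro a c hac - ⟨l, hl⟩
    exact ⟨a :: l, .cons _ _ (hac ▸ hl)⟩

open Classical in
/-- The list of vertices on the way from `x` to the root. -/
noncomputable def rootPath (p : V → Option V) (x : V) : List V :=
  if h : ∃ l, RootPath p (some x) l then h.choose else []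

theorem RootPath.eq_rootPath {x : V} {l : List V} (h : RootPath p (some x) l) :
    rootPath p x = l := by
  have h' : ∃ l, RootPath p (some x) l := ⟨l, h⟩
  rw [rootPath, dif_pos h']
  exact h'.choose_spec.unique h

theorem RootPath.rotate_of_notMem (huv : p v = some u)
    {o : Option V} {l : List V} (hl : RootPath p o l)
    (ho : ∀ x, o = some x → x ∉ subtreeVerts p u) : RootPath (rotate G p u v) o l := by
  induction hl with
  | nil => exact .nil
  | cons x l _ ih =>
    have hx := ho x rfl
    have h' : rotate G p u v x = p x := by
      refine rotate_of_not_moved ?_ ?_ ?_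
      · rintro rfl
        exact hx (mem_subtreeVerts_of_parent huv)
      · rintro rfl
        exact hx (mem_subtreeVerts_self p x)
      · rintro ⟨h1, -⟩
        exact hx (mem_subtreeVerts_trans (mem_subtreeVerts_of_parent h1)
          (mem_subtreeVerts_of_parent huv))
    refine .cons _ _ (h' ▸ ih fun y hy hyu => hx ?_)
    exact mem_subtreeVerts_trans (mem_subtreeVerts_of_parent hy) hyu

/-- The effect of a rotation on the paths to the root. -/
theorem IsElimTree.rootPath_rotate (h : IsElimTree G p) (huv : p v = some u) (w : V) :
    rootPath (rotate G p u v) w = rootPath p w ∨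
    ∃ a b, (w ∈ subtreeVerts p u ∧ w ∉ subtreeVerts p v ∧ rootPath p w = a ++ u :: b ∧
        rootPath (rotate G p u v) w = a ++ u :: v :: b) ∨
      (rootPath p w = a ++ v :: u :: b ∧ rootPath (rotate G p u v) w = a ++ u :: v :: b) ∨
      (w ∈ subtreeVerts p v ∧ w ∉ subtreeVerts (rotate G p u v) u ∧
        rootPath p w = a ++ v :: u :: b ∧ rootPath (rotate G p u v) w = a ++ v :: b) := by
  have hne := h.ne_of_parent huv
  by_cases hwu : w ∉ subtreeVerts p u
  · left
    obtain ⟨l, hl⟩ := h.exists_rootPath (some w)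
    have hl' := RootPath.rotate_of_notMem (G := G) huv hl (by simpa using hwu)
    rw [hl.eq_rootPath, hl'.eq_rootPath]
  right
  rw [not_not] at hwu
  obtain ⟨b, hb⟩ := h.exists_rootPath (p u)
  have hb' := RootPath.rotate_of_notMem (G := G) huv hb fun x hx => h.notMem_child hx
  have hv' : RootPath (rotate G p u v) (some v) (v :: b) :=
    .cons _ _ (by rwa [rotate_child])
  have hu' : RootPath (rotate G p u v) (some u) (u :: v :: b) :=
    .cons _ _ (by rwa [rotate_parent hne])
  have hu : RootPath p (some u) (u :: b) := .cons _ _ hb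
  have hv : RootPath p (some v) (v :: u :: b) := .cons _ _ (by rwa [huv])
  by_cases hwv : w ∈ subtreeVerts p v
  · have key : ∀ w ∈ subtreeVerts p v, ∃ a, RootPath p (some w) (a ++ v :: u :: b) ∧
        (RootPath (rotate G p u v) (some w) (a ++ u :: v :: b) ∨
          w ∉ subtreeVerts (rotate G p u v) u ∧
          RootPath (rotate G p u v) (some w) (a ++ v :: b)) := by
      intro w hw
      have hvcase : v ∉ subtreeVerts (rotate G p u v) u := fun h' =>
        (h.mem_rotate_parent_subset huv h').2 rfl
      induction hw using Relation.ReflTransGen.head_induction_on with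
      | refl => exact ⟨[], hv, Or.inr ⟨hvcase, hv'⟩⟩
      | @head x z hxz hz ih =>
        rcases rotate_cases (G := G) (p := p) hne x with ⟨rfl, h1⟩ | ⟨rfl, h1⟩ |
          ⟨h1, h2, h3, h3', h4⟩ | ⟨h1, h2, h3, h4⟩
        · exact ⟨[], hv, Or.inr ⟨hvcase, hv'⟩⟩
        · exact absurd (mem_subtreeVerts_trans (mem_subtreeVerts_of_parent hxz) hz)
            (h.notMem_child huv)
        · exact ⟨[x], .cons _ _ (by rwa [h3]), Or.inl (.cons _ _ (by rwa [h4]))⟩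
        · obtain ⟨a, ha, ha'⟩ := ih
          refine ⟨x :: a, .cons _ _ (by rwa [hxz]), ?_⟩
          rcases ha' with ha' | ⟨hzu, ha'⟩
          · exact Or.inl (.cons _ _ (by rwa [h4, hxz]))
          · refine Or.inr ⟨fun h5 => hzu ?_, .cons _ _ (by rwa [h4, hxz])⟩
            exact ((mem_subtreeVerts_iff_of_parent (h4.trans hxz)).1 h5).resolve_left h2
    obtain ⟨a, ha, ha' | ⟨hwu', ha'⟩⟩ := key w hwv
    · exact ⟨a, b, Or.inr (Or.inl ⟨ha.eq_rootPath, ha'.eq_rootPath⟩)⟩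
    · exact ⟨a, b, Or.inr (Or.inr ⟨hwv, hwu', ha.eq_rootPath, ha'.eq_rootPath⟩)⟩
  · have key : ∀ w ∈ subtreeVerts p u, w ∉ subtreeVerts p v → ∃ a,
        RootPath p (some w) (a ++ u :: b) ∧
        RootPath (rotate G p u v) (some w) (a ++ u :: v :: b) := by
      intro w hw
      induction hw using Relation.ReflTransGen.head_induction_on with
      | refl => exact fun _ => ⟨[], hu, hu'⟩
      | @head x z hxz hz ih =>
        intro hx
        rcases rotate_cases (G := G) (p := p) hne x with ⟨rfl, h1⟩ | ⟨rfl, h1⟩ |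
          ⟨h1, h2, h3, h3', h4⟩ | ⟨h1, h2, h3, h4⟩
        · exact absurd (mem_subtreeVerts_self p x) hx
        · exact ⟨[], hu, hu'⟩
        · exact absurd (mem_subtreeVerts_of_parent h3) hx
        · obtain ⟨a, ha, ha'⟩ := ih fun h5 =>
            hx (mem_subtreeVerts_trans (mem_subtreeVerts_of_parent hxz) h5)
          exact ⟨x :: a, .cons _ _ (by rwa [hxz]), .cons _ _ (by rwa [h4, hxz])⟩
    obtain ⟨a, ha, ha'⟩ := key w hwu hwv
    exact ⟨a, b, Or.inl ⟨hwu, hwv, ha.eq_rootPath, ha'.eq_rootPath⟩⟩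

end RootPath

/-! ### Counting alternations in lists -/

section Alternations

variable {γ : Type*} [DecidableEq γ]

/-- The number of pairs of unequal neighbours in a list. -/
def alternations : List γ → ℕ
  | [] => 0
  | [_] => 0
  | a :: b :: l => (if a = b then 0 else 1) + alternations (b :: l)

theorem alternations_le_cons (x : γ) (l : List γ) : alternations l ≤ alternations (x :: l) := by
  cases l <;> simp [alternations]

theorem alternations_cons_le (x : γ) (l : List γ) :
    alternations (x :: l) ≤ alternations l + 1 := by
  cases l with
  | nil => simp [alternations]
  | cons y l =>
    simp only [alternations]
    split_ifs <;> omega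

theorem alternations_le_append (a b : List γ) : alternations b ≤ alternations (a ++ b) := by
  induction a with
  | nil => exact le_rfl
  | cons x a ih => exact ih.trans (alternations_le_cons x _)

/-- This is the triangle inequality for the discrete metric, applied to the two neighbours of the
inserted entry. -/
theorem alternations_le_insert (a b : List γ) (x : γ) :
    alternations (a ++ b) ≤ alternations (a ++ x :: b) := by
  induction a with
  | nil => exact alternations_le_cons x b
  | cons y a ih =>
    cases a with
    | cons z a => simpa [alternations] using ih
    | nil =>
      cases b with
      | nil => simp [alternations]
      | cons z b =>
        simp only [List.cons_append, List.nil_append, alternations]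
        split_ifs <;> first | omega | (exfalso; simp_all)

theorem alternations_insert_le (a b : List γ) (x : γ) :
    alternations (a ++ x :: b) ≤ alternations (a ++ b) + 2 := by
  induction a with
  | nil => exact (alternations_cons_le x b).trans (by simp)
  | cons y a ih =>
    cases a with
    | cons z a =>
      simp only [List.cons_append, alternations] at ih ⊢
      omega
    | nil =>
      cases b with
      | nil =>
        simp only [List.cons_append, List.nil_append, alternations]
        split_ifs <;> omega
      | cons z b =>
        simp only [List.cons_append, List.nil_append, alternations]
        split_ifs <;> omega

theorem alternations_insert_same (a b : List γ) (x : γ) :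
    alternations (a ++ x :: x :: b) = alternations (a ++ x :: b) := by
  induction a with
  | nil => simp [alternations]
  | cons y a ih =>
    cases a with
    | cons z a => simpa [alternations] using ih
    | nil => simp [alternations]

end Alternations

/-! ### The label-change potential -/

section Potential

variable {V : Type u} {G : SimpleGraph V} {p : V → Option V} {u v : V} {γ : Type*} [DecidableEq γ]

/-- The number of label changes on the way from `w` to the root, unlabelled vertices omitted. -/
noncomputable def labelChanges (f : V → Option γ) (p : V → Option V) (w : V) : ℕ :=
  alternations ((rootPath p w).filterMap f)

/-- The subtree of `u` is connected, and since `K` can be left only from `w`, a walk in it from `w`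
to `v` can be cut down to one inside `K`. That walk avoids `u`, so it stays below a single child of
`u`, namely `v`. -/
theorem IsElimTree.mem_child_of_portal [Finite V] (h : IsElimTree G p) (huv : p v = some u)
    {K : Set V} {w : V} (hK : ∀ x y, G.Adj x y → x ∈ K → y ∉ K → x = w)
    (hv : v ∈ K) (hu : u ∉ K) (hwu : w ∈ subtreeVerts p u) : w ∈ subtreeVerts p v := by
  have key : ∀ x, JoinedInside G (subtreeVerts p u) w x → x ∈ K →
      JoinedInside G (subtreeVerts p u ∩ K) w x := by
    intro x hx
    induction hx with
    | refl => exact fun _ => .refl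
    | @tail x y _ hxy ih =>
      intro hy
      by_cases hx : x ∈ K
      · exact (ih hx).tail ⟨hxy.1, ⟨hxy.2.1, hx⟩, hxy.2.2, hy⟩
      · rw [hK y x hxy.1.symm hy hx]
        exact .refl
  have h1 := key v (h.preconnectedSet u w hwu v (mem_subtreeVerts_of_parent huv)) hv
  refine h1.symm.mem_of_closed (mem_subtreeVerts_self p v) fun m n hm _ hn hmn => ?_
  rcases h.comparable hmn with h2 | h2
  · rcases subtreeVerts_total hm h2 with h3 | h3
    · rcases (mem_subtreeVerts_iff_of_parent huv).1 h3 with rfl | h3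
      · exact mem_subtreeVerts_self p v
      · exact absurd (h.antisymm hn.1 h3 ▸ hn.2) hu
    · exact h3
  · exact mem_subtreeVerts_trans h2 hm

/-- A rotation inserts `v` next to `u`, deletes `u` next to `v`, or swaps the two. Equal labels make
all of these invisible, and so does a missing label, unless the inserted or deleted vertex is the
only labelled one of the two. `mem_child_of_portal` excludes this, applied before the rotation for
an insertion and after it for a deletion. -/
theorem IsElimTree.labelChanges_rotate_eq [Finite V] (h : IsElimTree G p) (huv : p v = some u)
    {f : V → Option γ} {w : V}
    (hf : ∀ x y, G.Adj x y → f x ≠ none → f y = none → x = w)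
    (hsame : f u = f v ∨ f u = none ∨ f v = none) :
    labelChanges f (rotate G p u v) w = labelChanges f p w := by
  have hK : ∀ x y, G.Adj x y → x ∈ {x | f x ≠ none} → y ∉ {x | f x ≠ none} → x = w :=
    fun x y hxy hx hy => hf x y hxy hx (not_not.1 hy)
  unfold labelChanges
  rcases h.rootPath_rotate huv w with h1 | ⟨a, b, ⟨hwu, hwv, h1, h2⟩ | ⟨h1, h2⟩ |
    ⟨hwv, hwu, h1, h2⟩⟩
  · rw [h1]
  · rw [h1, h2]
    cases hv : f v with
    | none => simp [List.filterMap_cons, hv]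
    | some c =>
      cases hu : f u with
      | none => exact absurd (h.mem_child_of_portal huv (K := {x | f x ≠ none}) hK (by simp [hv])
          (by simp [hu]) hwu) hwv
      | some d =>
        obtain rfl : d = c := by simpa [hu, hv] using hsame
        simp [hu, hv, alternations_insert_same]
  · rw [h1, h2]
    cases hv : f v with
    | none => simp [List.filterMap_cons, hv]
    | some c =>
      cases hu : f u with
      | none => simp [List.filterMap_cons, hu]
      | some d =>
        obtain rfl : d = c := by simpa [hu, hv] using hsame
        simp [hu, hv]
  · rw [h1, h2]
    cases hu : f u with
    | none => simp [List.filterMap_cons, hu]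
    | some c =>
      cases hv : f v with
      | none =>
        refine absurd ((h.isElimTree_rotate huv).mem_child_of_portal (rotate_parent (h.ne_of_parent huv))
          (K := {x | f x ≠ none}) hK (by simp [hu]) (by simp [hv]) ?_) hwu
        exact (h.mem_rotate_child huv w).2
          (mem_subtreeVerts_trans hwv (mem_subtreeVerts_of_parent huv))
      | some d =>
        obtain rfl : c = d := by simpa [hu, hv] using hsame
        simp [hu, hv, alternations_insert_same]

theorem alternations_filterMap_insert (f : V → Option γ) (a b : List V) (x : V) :
    alternations ((a ++ b).filterMap f) ≤ alternations ((a ++ x :: b).filterMap f) ∧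
    alternations ((a ++ x :: b).filterMap f) ≤ alternations ((a ++ b).filterMap f) + 2 := by
  cases hx : f x with
  | none => simp [hx]
  | some c =>
    simp only [List.filterMap_append, List.filterMap_cons, hx]
    exact ⟨alternations_le_insert _ _ _, alternations_insert_le _ _ _⟩

theorem IsElimTree.labelChanges_rotate_le (h : IsElimTree G p) (huv : p v = some u)
    (f : V → Option γ) (w : V) :
    labelChanges f (rotate G p u v) w ≤ labelChanges f p w + 2 ∧
    labelChanges f p w ≤ labelChanges f (rotate G p u v) w + 2 := by
  unfold labelChanges
  rcases h.rootPath_rotate huv w with h1 | ⟨a, b, ⟨-, -, h1, h2⟩ | ⟨h1, h2⟩ | ⟨-, -, h1, h2⟩⟩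
  · rw [h1]; omega
  · have := alternations_filterMap_insert f (a ++ [u]) b v
    simp only [List.append_assoc, List.singleton_append] at this
    rw [h1, h2]; omega
  -- Both orders of `u` and `v` arise by inserting `v` into the same list `a ++ u :: b`, so their
  -- counts lie in a common interval of length two.
  · have h3 := alternations_filterMap_insert f (a ++ [u]) b v
    have h4 := alternations_filterMap_insert f a (u :: b) v
    simp only [List.append_assoc, List.singleton_append] at h3
    rw [h1, h2]; omega
  · have := alternations_filterMap_insert f (a ++ [v]) b u
    simp only [List.append_assoc, List.singleton_append] at this
    rw [h1, h2]; omega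

/-- A family of labellings is separated by `G` if each labelled region is entered only through its
index, and any two vertices get distinct labels in at most one labelling. -/
structure IsSeparatedLabelling (G : SimpleGraph V) (W : Finset V) (f : V → V → Option γ) :
    Prop where
  portal : ∀ w ∈ W, ∀ x y, G.Adj x y → f w x ≠ none → f w y = none → x = w
  unique : ∀ u v, ∀ w ∈ W, ∀ w' ∈ W, ¬ (f w u = f w v ∨ f w u = none ∨ f w v = none) →
    ¬ (f w' u = f w' v ∨ f w' u = none ∨ f w' v = none) → w = w'

/-- At most one index `w₀` gives `u` and `v` distinct labels; all other summands are unchanged. -/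
theorem IsSeparatedLabelling.sum_rotate_le [Finite V] {W : Finset V} {f : V → V → Option γ}
    (hf : IsSeparatedLabelling G W f) (h : IsElimTree G p) (huv : p v = some u) :
    ∑ w ∈ W, labelChanges (f w) (rotate G p u v) w ≤ ∑ w ∈ W, labelChanges (f w) p w + 2 ∧
    ∑ w ∈ W, labelChanges (f w) p w ≤ ∑ w ∈ W, labelChanges (f w) (rotate G p u v) w + 2 := by
  classical
  by_cases hex : ∃ w₀ ∈ W, ¬ (f w₀ u = f w₀ v ∨ f w₀ u = none ∨ f w₀ v = none)
  · obtain ⟨w₀, hw₀, hne⟩ := hex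
    have heq : ∑ w ∈ W.erase w₀, labelChanges (f w) (rotate G p u v) w =
        ∑ w ∈ W.erase w₀, labelChanges (f w) p w := by
      refine Finset.sum_congr rfl fun w hw => ?_
      obtain ⟨hww₀, hw⟩ := Finset.mem_erase.1 hw
      refine h.labelChanges_rotate_eq huv (hf.portal w hw) ?_
      by_contra hcon
      exact hww₀ (hf.unique u v w hw w₀ hw₀ hcon hne)
    rw [← Finset.add_sum_erase _ _ hw₀, ← Finset.add_sum_erase _ _ hw₀, heq]
    have := h.labelChanges_rotate_le huv (f w₀) w₀
    omega
  · push Not at hex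
    rw [Finset.sum_congr rfl fun w hw =>
      h.labelChanges_rotate_eq huv (hf.portal w hw) (hex w hw)]
    omega

/-- Every rotation changes the total number of label changes by at most two. -/
theorem IsSeparatedLabelling.sum_le_walk [Finite V] (hG : G.Preconnected) {W : Finset V}
    {f : V → V → Option γ} (hf : IsSeparatedLabelling G W f) {T T' : SearchTree G}
    (c : (rotationGraph G).Walk T T') :
    ∑ w ∈ W, labelChanges (f w) T.parent w ≤
      ∑ w ∈ W, labelChanges (f w) T'.parent w + 2 * c.length := by
  induction c with
  | nil => simp
  | @cons T₁ T₂ T₃ hadj c ih =>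
    rw [rotationGraph, SimpleGraph.fromRel_adj] at hadj
    rw [SimpleGraph.Walk.length_cons]
    -- Either of two adjacent trees may be the one that is rotated, so both inequalities are needed.
    rcases hadj.2 with ⟨u, v, huv, h⟩ | ⟨u, v, huv, h⟩
    · have := (hf.sum_rotate_le (T₁.isElimTree hG) huv).2
      rw [← h] at this
      omega
    · have := (hf.sum_rotate_le (T₂.isElimTree hG) huv).1
      rw [← h] at this
      omega

theorem IsSeparatedLabelling.sum_le_diam [Fintype V] (hG : G.IsTree) {W : Finset V}
    {f : V → V → Option γ} (hf : IsSeparatedLabelling G W f) (T T' : SearchTree G) :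
    ∑ w ∈ W, labelChanges (f w) T.parent w ≤
      ∑ w ∈ W, labelChanges (f w) T'.parent w + 2 * (rotationGraph G).diam := by
  -- `diam` would be `0` if `ediam` were infinite; the upper bound rules this out.
  have htop : (rotationGraph G).ediam ≠ ⊤ :=
    ne_top_of_le_ne_top (ENat.natCast_ne_top _) (ediam_rotationGraph_le hG)
  obtain ⟨c, hc⟩ := (SimpleGraph.preconnected_of_ediam_ne_top htop T T').exists_walk_length_eq_dist
  have h1 := hf.sum_le_walk hG.connected.preconnected c
  have h2 := SimpleGraph.dist_le_diam htop (u := T) (v := T')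
  omega

end Potential

/-! ### Trees of binary words -/

section WordTree

variable {V : Type u} (word : V → List Bool)

/-- The graph joining every vertex to those whose word extends its own word by one letter. -/
def wordGraph : SimpleGraph V :=
  SimpleGraph.fromRel fun x y => ∃ b : Bool, word y = word x ++ [b]

/-- The words of the vertices are distinct and closed under taking prefixes. -/
structure IsWordTree : Prop where
  injective : Function.Injective word
  closed : ∀ x l b, word x = l ++ [b] → ∃ y, word y = l

open Classical in
/-- The vertex whose word is obtained by deleting the last letter. -/
noncomputable def wordParent (x : V) : Option V :=
  if h : ∃ y, ∃ b : Bool, word x = word y ++ [b] then some h.choose else none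

variable {word}

theorem wordGraph_adj_iff {x y : V} : (wordGraph word).Adj x y ↔
    (∃ b, word y = word x ++ [b]) ∨ ∃ b, word x = word y ++ [b] := by
  rw [wordGraph, SimpleGraph.fromRel_adj]
  refine ⟨fun h => h.2, fun h => ⟨?_, h⟩⟩
  rintro rfl
  simp at h

theorem IsWordTree.wordParent_eq_some_iff (hw : IsWordTree word) {x y : V} :
    wordParent word x = some y ↔ ∃ b, word x = word y ++ [b] := by
  unfold wordParent
  split_ifs with h
  · rw [Option.some_inj]
    constructor
    · rintro rfl
      exact h.choose_spec
    · rintro ⟨b, hb⟩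
      obtain ⟨b', hb'⟩ := h.choose_spec
      exact hw.injective (List.append_inj_left' (hb'.symm.trans hb) rfl)
  · simp only [false_iff]
    exact fun h' => h ⟨y, h'⟩

theorem IsWordTree.wordParent_eq_none_iff (hw : IsWordTree word) {x : V} :
    wordParent word x = none ↔ word x = [] := by
  constructor
  · intro h
    rcases List.eq_nil_or_concat' (word x) with h' | ⟨l, b, h'⟩
    · exact h'
    · obtain ⟨y, rfl⟩ := hw.closed x l b h'
      rw [hw.wordParent_eq_some_iff.2 ⟨b, h'⟩] at h
      simp at h
  · intro h
    rw [Option.eq_none_iff_forall_ne_some]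
    intro y hy
    obtain ⟨b, hb⟩ := hw.wordParent_eq_some_iff.1 hy
    simp [h] at hb

theorem IsWordTree.exists_word_parent (hw : IsWordTree word) {x : V} (hx : word x ≠ []) :
    ∃ y, wordParent word x = some y ∧ (word x).length = (word y).length + 1 ∧
      (wordGraph word).Adj x y := by
  rcases List.eq_nil_or_concat' (word x) with h' | ⟨l, b, h'⟩
  · exact absurd h' hx
  · obtain ⟨y, rfl⟩ := hw.closed x l b h'
    exact ⟨y, hw.wordParent_eq_some_iff.2 ⟨b, h'⟩, by simp [h'],
      wordGraph_adj_iff.2 (Or.inr ⟨b, h'⟩)⟩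

theorem IsWordTree.mem_subtreeVerts_root (hw : IsWordTree word) {r : V} (hr : word r = []) (x : V) :
    x ∈ subtreeVerts (wordParent word) r := by
  induction hn : (word x).length using Nat.strong_induction_on generalizing x with
  | _ n ih =>
    by_cases hx : word x = []
    · rw [hw.injective (hx.trans hr.symm)]
      exact mem_subtreeVerts_self _ r
    · obtain ⟨y, hy, hlen, -⟩ := hw.exists_word_parent hx
      exact mem_subtreeVerts_trans (mem_subtreeVerts_of_parent hy) (ih _ (by omega) y rfl)

theorem IsWordTree.exists_root (hw : IsWordTree word) [h : Nonempty V] : ∃ r, word r = [] := by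
  obtain ⟨x⟩ := h
  induction hn : (word x).length using Nat.strong_induction_on generalizing x with
  | _ n ih =>
    by_cases hx : word x = []
    · exact ⟨x, hx⟩
    · obtain ⟨y, hy, hlen, -⟩ := hw.exists_word_parent hx
      exact ih _ (by omega) y rfl

theorem IsWordTree.prefix_of_mem_subtreeVerts (hw : IsWordTree word) {x y : V}
    (h : x ∈ subtreeVerts (wordParent word) y) : word y <+: word x := by
  induction h using Relation.ReflTransGen.head_induction_on with
  | refl => exact List.prefix_rfl
  | head h _ ih =>
    obtain ⟨b, hb⟩ := hw.wordParent_eq_some_iff.1 h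
    exact ih.trans (hb ▸ List.prefix_append _ _)

theorem IsWordTree.isElimTree_wordParent (hw : IsWordTree word) [Nonempty V] :
    IsElimTree (wordGraph word) (wordParent word) := by
  obtain ⟨r, hr⟩ := hw.exists_root
  refine ⟨⟨r, hw.wordParent_eq_none_iff.2 hr, hw.mem_subtreeVerts_root hr⟩, fun x y hxy => ?_,
    fun c x hc => ⟨c, mem_subtreeVerts_self _ c, ?_⟩⟩
  · rcases wordGraph_adj_iff.1 hxy with h | h
    · exact Or.inr (mem_subtreeVerts_of_parent (hw.wordParent_eq_some_iff.2 h))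
    · exact Or.inl (mem_subtreeVerts_of_parent (hw.wordParent_eq_some_iff.2 h))
  · exact wordGraph_adj_iff.2 (Or.inl (hw.wordParent_eq_some_iff.1 hc))

theorem IsWordTree.isTree (hw : IsWordTree word) [Nonempty V] : (wordGraph word).IsTree := by
  obtain ⟨r, hr⟩ := hw.exists_root
  have hreach : ∀ x, (wordGraph word).Reachable x r := by
    intro x
    induction hw.mem_subtreeVerts_root hr x using Relation.ReflTransGen.head_induction_on with
    | refl => rfl
    | head h _ ih =>
      exact SimpleGraph.Reachable.trans (SimpleGraph.Adj.reachable
        (wordGraph_adj_iff.2 (Or.inr (hw.wordParent_eq_some_iff.1 h)))) ih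
  refine ⟨⟨fun x y => (hreach x).trans (hreach y).symm⟩, ?_⟩
  rw [SimpleGraph.isAcyclic_iff_forall_adj_isBridge]
  have key : ∀ x y b, word y = word x ++ [b] → (wordGraph word).IsBridge s(y, x) := by
    intro x y b hb
    rw [SimpleGraph.isBridge_iff, SimpleGraph.reachable_iff_reflTransGen]
    intro h
    -- Once the edge between `y` and its parent `x` is deleted, a walk from `y` never leaves the set
    -- of words extending `word y`.
    have hinv : word y <+: word x := by
      refine Relation.ReflTransGen.rec (motive := fun z _ => word y <+: word z)
        List.prefix_rfl (fun {z z'} _ hzz' hz => ?_) h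
      rw [SimpleGraph.deleteEdges_adj, wordGraph_adj_iff] at hzz'
      obtain ⟨⟨c, hc⟩ | ⟨c, hc⟩, hne⟩ := hzz'
      · exact hz.trans (hc ▸ List.prefix_append _ _)
      · rw [hc, List.prefix_concat_iff] at hz
        rcases hz with hz | hz
        · rw [← hc] at hz
          obtain rfl := hw.injective hz
          obtain rfl := hw.injective (List.append_inj_left' (hb.symm.trans hc) rfl)
          simp at hne
        · exact hz
    have := hinv.length_le
    simp [hb] at this
  intro x y hxy
  rcases wordGraph_adj_iff.1 hxy with ⟨b, hb⟩ | ⟨b, hb⟩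
  · rw [Sym2.eq_swap]
    exact key x y b hb
  · exact key y x b hb

end WordTree

/-! ### Next-letter labels and bit-reversed order -/

section Labels

/-- The letter of `l` following the prefix `w`, if `w` is a prefix of `l`. -/
def letterAfter (w l : List Bool) : Option (Option Bool) :=
  if w <+: l then some l[w.length]? else none

theorem letterAfter_eq_none_iff {w l : List Bool} : letterAfter w l = none ↔ ¬ w <+: l := by
  simp [letterAfter]

theorem letterAfter_cons (a b : Bool) (w l : List Bool) :
    letterAfter (a :: w) (b :: l) = if a = b then letterAfter w l else none := by
  simp only [letterAfter, List.cons_prefix_cons, List.length_cons, List.getElem?_cons_succ]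
  split_ifs <;> simp_all

theorem letterAfter_eq_of_length_lt {w w' l l' : List Bool} (hw : w <+: l) (hw' : w <+: l')
    (h : w' <+: l) (h' : w' <+: l') (hlt : w.length < w'.length) :
    letterAfter w l = letterAfter w l' := by
  obtain ⟨s, rfl⟩ := h
  obtain ⟨s', rfl⟩ := h'
  simp [letterAfter, hw, hw', List.getElem?_append_left hlt]

/-- An edge leaving the words that extend `word w` must start at `w`. If two words receive distinct
labels for `w`, then `word w` is their longest common prefix; this includes the case that one of
them is `word w`, with label `some none`. -/
theorem isSeparatedLabelling_letterAfter {V : Type u} {word : V → List Bool}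
    (hw : IsWordTree word) (W : Finset V) :
    IsSeparatedLabelling (wordGraph word) W fun w x => letterAfter (word w) (word x) := by
  refine ⟨fun w _ x y hxy hx hy => ?_, fun u v w _ w' _ h h' => ?_⟩
  · rw [Ne, letterAfter_eq_none_iff, not_not] at hx
    rw [letterAfter_eq_none_iff] at hy
    rcases wordGraph_adj_iff.1 hxy with ⟨b, hb⟩ | ⟨b, hb⟩
    · exact absurd (hx.trans (hb ▸ List.prefix_append _ _)) hy
    · rw [hb, List.prefix_concat_iff, ← hb] at hx
      exact (hw.injective (hx.resolve_right hy)).symm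
  · simp only [letterAfter_eq_none_iff, not_or, not_not] at h h'
    rcases lt_trichotomy (word w).length (word w').length with hlt | heq | hlt
    · exact absurd (letterAfter_eq_of_length_lt h.2.1 h.2.2 h'.2.1 h'.2.2 hlt) h.1
    · refine hw.injective ?_
      rcases List.prefix_or_prefix_of_prefix h.2.1 h'.2.1 with h1 | h1
      · exact h1.eq_of_length heq
      · exact (h1.eq_of_length heq.symm).symm
    · exact absurd (letterAfter_eq_of_length_lt h'.2.1 h'.2.2 h.2.1 h.2.2 hlt) h'.1

/-- The words of length `m`, in the order in which their letters alternate at every position. -/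
def bitReversal : ℕ → List (List Bool)
  | 0 => [[]]
  | m + 1 => (bitReversal m).flatMap fun l => [false :: l, true :: l]

theorem mem_bitReversal {m : ℕ} {l : List Bool} : l ∈ bitReversal m ↔ l.length = m := by
  induction m generalizing l with
  | zero => simp [bitReversal]
  | succ m ih =>
    cases l with
    | nil => simp [bitReversal]
    | cons b l => cases b <;> simp [bitReversal, ih]

theorem length_bitReversal (m : ℕ) : (bitReversal m).length = 2 ^ m := by
  induction m with
  | zero => rfl
  | succ m ih => simp [bitReversal, List.length_flatMap, ih, pow_succ]

theorem nodup_bitReversal (m : ℕ) : (bitReversal m).Nodup := by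
  induction m with
  | zero => simp [bitReversal]
  | succ m ih =>
    rw [bitReversal, List.nodup_flatMap]
    refine ⟨fun l _ => by simp, ih.imp fun {a b} hab => ?_⟩
    simp [Function.onFun, Ne.symm hab]

theorem alternations_flatMap_pair {α γ : Type*} [DecidableEq γ] {a b : γ} (hab : a ≠ b) (L : List α)
    (hL : L ≠ []) : alternations (L.flatMap fun _ => [a, b]) + 1 = 2 * L.length := by
  induction L with
  | nil => exact absurd rfl hL
  | cons x L ih =>
    cases L with
    | nil => simp [alternations, hab]
    | cons y L =>
      have := ih (by simp)
      simp only [List.flatMap_cons, List.cons_append, List.nil_append, alternations, hab, hab.symm,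
        if_false, List.length_cons] at this ⊢
      omega

/-- The first letter alternates at every step of the list, and the words beginning with a given
letter have as their tails the list one size smaller, in order. Hence the `2 ^ (m - |w|)` words
extending `w` alternate in the letter after `w`. -/
theorem alternations_bitReversal {m : ℕ} {w : List Bool} (hw : w.length < m) :
    alternations ((bitReversal m).filterMap (letterAfter w)) + 1 = 2 ^ (m - w.length) := by
  induction m generalizing w with
  | zero => simp at hw
  | succ m ih =>
    cases w with
    | nil =>
      have h : (bitReversal (m + 1)).filterMap (letterAfter []) =
          (bitReversal m).flatMap fun _ => [some false, some true] := by
        rw [bitReversal, List.filterMap_flatMap]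
        simp [letterAfter]
      have hne : bitReversal m ≠ [] := by
        rw [← List.length_pos_iff, length_bitReversal]
        positivity
      rw [h, alternations_flatMap_pair (by simp) _ hne, length_bitReversal]
      simp [pow_succ, mul_comm]
    | cons a w =>
      have h : ∀ L : List (List Bool), (L.flatMap fun l => [false :: l, true :: l]).filterMap
          (letterAfter (a :: w)) = L.filterMap (letterAfter w) := by
        intro L
        induction L with
        | nil => rfl
        | cons l L ih =>
          cases a <;> simp [List.filterMap_cons, letterAfter_cons, ih]
      rw [bitReversal, h, ih (by simpa using hw)]
      simp

end Labels

/-! ### The search tree with one level of words on top -/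

section LeafChain

variable {V : Type u} {word : V → List Bool} {m : ℕ} {L : List V}

open Classical in
/-- The vertices of `L` form a path above the root of the word tree, the last one being on top. -/
noncomputable def leafChainParent (word : V → List Bool) (L : List V) (x : V) : Option V :=
  if x ∈ L then L[L.idxOf x + 1]? else if word x = [] then L.head? else wordParent word x

/-- `L` enumerates the vertices with words of length `m`. -/
structure IsLevelList (word : V → List Bool) (m : ℕ) (L : List V) : Prop where
  nodup : L.Nodup
  mem_iff : ∀ x, x ∈ L ↔ (word x).length = m
  ne_nil : L ≠ []

theorem IsLevelList.leafChainParent_getElem (hL : IsLevelList word m L) {i : ℕ} (hi : i < L.length) :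
    leafChainParent word L L[i] = L[i + 1]? := by
  classical
  rw [leafChainParent, if_pos (List.getElem_mem hi), hL.nodup.idxOf_getElem]

theorem IsLevelList.rootPath_getElem (hL : IsLevelList word m L) (i : ℕ) :
    RootPath (leafChainParent word L) L[i]? (L.drop i) := by
  induction hn : L.length - i generalizing i with
  | zero =>
    rw [List.getElem?_eq_none (by omega), List.drop_eq_nil_of_le (by omega)]
    exact .nil
  | succ n ih =>
    have hi : i < L.length := by omega
    rw [List.getElem?_eq_getElem hi, List.drop_eq_getElem_cons hi]
    refine .cons _ _ ?_
    rw [hL.leafChainParent_getElem hi]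
    exact ih (i + 1) (by omega)

theorem IsLevelList.leafChainParent_of_length_ne (hL : IsLevelList word m L) {x : V}
    (hx : (word x).length ≠ m) (hx' : word x ≠ []) :
    leafChainParent word L x = wordParent word x := by
  rw [leafChainParent, if_neg (fun h => hx ((hL.mem_iff x).1 h)), if_neg hx']

theorem IsLevelList.leafChainParent_root (hL : IsLevelList word m L) (hm : m ≠ 0) {x : V}
    (hx : word x = []) : leafChainParent word L x = L.head? := by
  rw [leafChainParent, if_neg, if_pos hx]
  rw [hL.mem_iff, hx]
  exact hm.symm

/-- Paths from vertices above the level end with the whole list. -/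
theorem IsLevelList.exists_rootPath (hL : IsLevelList word m L) (hw : IsWordTree word) {x : V}
    (hx : (word x).length < m) : ∃ a, RootPath (leafChainParent word L) (some x) (a ++ L) := by
  induction hn : (word x).length generalizing x with
  | zero =>
    refine ⟨[x], .cons _ _ ?_⟩
    rw [hL.leafChainParent_root (by omega) (List.length_eq_zero_iff.1 hn), List.head?_eq_getElem?]
    exact hL.rootPath_getElem 0
  | succ n ih =>
    have hx' : word x ≠ [] := fun h => by simp [h] at hn
    obtain ⟨y, hy, hlen, -⟩ := hw.exists_word_parent hx'
    obtain ⟨a, ha⟩ := ih (x := y) (by omega) (by omega)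
    refine ⟨x :: a, .cons _ _ ?_⟩
    rwa [hL.leafChainParent_of_length_ne hx.ne hx', hy]

theorem IsLevelList.mem_subtreeVerts_of_lt (hL : IsLevelList word m L) (hw : IsWordTree word)
    {x y : V} (hx : (word x).length < m) (hy : y ∈ L) :
    x ∈ subtreeVerts (leafChainParent word L) y := by
  obtain ⟨a, ha⟩ := hL.exists_rootPath hw hx
  exact ha.mem_subtreeVerts rfl (List.mem_append_right _ hy)

theorem IsLevelList.mem_subtreeVerts_root (hL : IsLevelList word m L) (hw : IsWordTree word)
    {x r : V} (hx : (word x).length < m) (hr : word r = []) :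
    x ∈ subtreeVerts (leafChainParent word L) r := by
  induction hn : (word x).length generalizing x with
  | zero =>
    rw [hw.injective ((List.length_eq_zero_iff.1 hn).trans hr.symm)]
    exact mem_subtreeVerts_self _ r
  | succ n ih =>
    have hx' : word x ≠ [] := fun h => by simp [h] at hn
    obtain ⟨y, hy, hlen, -⟩ := hw.exists_word_parent hx'
    have := hL.leafChainParent_of_length_ne hx.ne hx'
    exact mem_subtreeVerts_trans (mem_subtreeVerts_of_parent (this.trans hy))
      (ih (x := y) (by omega) (by omega))

theorem IsLevelList.mem_subtreeVerts_last (hL : IsLevelList word m L) (hw : IsWordTree word)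
    (x : V) : x ∈ subtreeVerts (leafChainParent word L) (L.getLast hL.ne_nil) := by
  have hlast := List.getLast_mem hL.ne_nil
  induction hn : (word x).length using Nat.strong_induction_on generalizing x with
  | _ n ih =>
    rcases lt_trichotomy (word x).length m with hx | hx | hx
    · exact hL.mem_subtreeVerts_of_lt hw hx hlast
    · obtain ⟨i, hi, rfl⟩ := List.getElem_of_mem ((hL.mem_iff x).2 hx)
      have h1 := hL.rootPath_getElem i
      refine h1.mem_subtreeVerts (List.getElem?_eq_getElem hi) ?_
      rw [← List.getLast_drop (i := i) (by simpa using hi)]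
      exact List.getLast_mem _
    · have hx' : word x ≠ [] := fun h => by simp [h] at hx
      obtain ⟨y, hy, hlen, -⟩ := hw.exists_word_parent hx'
      have := hL.leafChainParent_of_length_ne hx.ne' hx'
      exact mem_subtreeVerts_trans (mem_subtreeVerts_of_parent (this.trans hy))
        (ih _ (by omega) y rfl)

/-- All shorter words lie below every vertex of `L`. They include the word-tree parent of each
vertex of `L`, which is the neighbour that `child_adj` demands along the path. Longer words keep
their word-tree parents. -/
theorem IsLevelList.isElimTree (hL : IsLevelList word m L) (hw : IsWordTree word) (hm : m ≠ 0) :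
    IsElimTree (wordGraph word) (leafChainParent word L) := by
  have hlenpos := List.length_pos_iff.2 hL.ne_nil
  refine ⟨⟨_, ?_, hL.mem_subtreeVerts_last hw⟩, ?_, ?_⟩
  · rw [List.getLast_eq_getElem, hL.leafChainParent_getElem]
    exact List.getElem?_eq_none (by omega)
  · have key : ∀ x y b, word x = word y ++ [b] →
        x ∈ subtreeVerts (leafChainParent word L) y ∨
        y ∈ subtreeVerts (leafChainParent word L) x := by
      intro x y b hb
      by_cases hx : (word x).length = m
      · refine Or.inr (hL.mem_subtreeVerts_of_lt hw ?_ ((hL.mem_iff x).2 hx))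
        simp only [hb, List.length_append, List.length_singleton] at hx
        omega
      · refine Or.inl (mem_subtreeVerts_of_parent ?_)
        rw [hL.leafChainParent_of_length_ne hx (by simp [hb])]
        exact hw.wordParent_eq_some_iff.2 ⟨b, hb⟩
    intro x y hxy
    rcases wordGraph_adj_iff.1 hxy with ⟨b, hb⟩ | ⟨b, hb⟩
    · exact (key y x b hb).symm
    · exact key x y b hb
  · have hadj : ∀ x ∈ L, ∃ y, (word y).length < m ∧ (wordGraph word).Adj x y := by
      intro x hx
      have hx' := (hL.mem_iff x).1 hx
      obtain ⟨y, -, hlen, hadj⟩ := hw.exists_word_parent (x := x) (fun h => hm (by simp [← hx', h]))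
      exact ⟨y, by omega, hadj⟩
    intro c x hc
    by_cases hcL : c ∈ L
    · obtain ⟨i, hi, rfl⟩ := List.getElem_of_mem hcL
      rw [hL.leafChainParent_getElem] at hc
      obtain ⟨y, hy, hxy⟩ := hadj x (List.mem_of_getElem? hc)
      exact ⟨y, hL.mem_subtreeVerts_of_lt hw hy hcL, hxy⟩
    by_cases hc' : word c = []
    · rw [hL.leafChainParent_root hm hc'] at hc
      obtain ⟨y, hy, hxy⟩ := hadj x (List.mem_of_head? hc)
      exact ⟨y, hL.mem_subtreeVerts_root hw hy hc', hxy⟩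
    · rw [hL.leafChainParent_of_length_ne (fun h => hcL ((hL.mem_iff c).2 h)) hc'] at hc
      exact ⟨c, mem_subtreeVerts_self _ c,
        wordGraph_adj_iff.2 (Or.inl (hw.wordParent_eq_some_iff.1 hc))⟩

end LeafChain

/-! ### The potential of the two extreme trees, and the lower bound -/

section LowerBound

variable {V : Type u} {word : V → List Bool} {m : ℕ}

theorem IsWordTree.exists_level (hw : IsWordTree word)
    (hfull : ∀ l : List Bool, l.length = m → ∃ x, word x = l) :
    ∃ L : List V, L.map word = bitReversal m ∧ IsLevelList word m L := by
  obtain ⟨L, hL⟩ : bitReversal m ∈ Set.range (List.map word) := by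
    rw [Set.range_list_map]
    exact fun l hl => hfull l (mem_bitReversal.1 hl)
  refine ⟨L, hL, List.Nodup.of_map word (hL ▸ nodup_bitReversal m), fun x => ?_, ?_⟩
  · rw [← mem_bitReversal, ← hL, List.mem_map_of_injective hw.injective]
  · rintro rfl
    have := length_bitReversal m
    rw [← hL] at this
    exact (pow_pos two_pos m).ne this

theorem IsWordTree.card_level [Fintype V] (hw : IsWordTree word)
    (hfull : ∀ l : List Bool, l.length = m → ∃ x, word x = l) :
    (Finset.univ.filter fun x => (word x).length = m).card = 2 ^ m := by
  classical
  obtain ⟨L, hL, hLm⟩ := hw.exists_level hfull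
  rw [← length_bitReversal, ← hL, List.length_map, ← List.toFinset_card_of_nodup hLm.nodup]
  congr 1
  ext x
  simp [hLm.mem_iff]

theorem alternations_eq_zero_of_forall_eq {γ : Type*} [DecidableEq γ] {c : γ} {l : List γ}
    (h : ∀ x ∈ l, x = c) : alternations l = 0 := by
  induction l with
  | nil => rfl
  | cons x l ih =>
    cases l with
    | nil => rfl
    | cons y l =>
      simp only [alternations, h x (by simp), h y (by simp), if_true, Nat.zero_add]
      rw [← h y (by simp)]
      exact ih fun z hz => h z (List.mem_cons_of_mem _ hz)

/-- The path from `w` to the root consists of prefixes of `w`, of which only `w` itself is labelled.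
-/
theorem IsWordTree.labelChanges_wordParent (hw : IsWordTree word) [Nonempty V] (w : V) :
    labelChanges (fun x => letterAfter (word w) (word x)) (wordParent word) w = 0 := by
  obtain ⟨l, hl⟩ := hw.isElimTree_wordParent.exists_rootPath (some w)
  rw [labelChanges, hl.eq_rootPath]
  refine alternations_eq_zero_of_forall_eq (c := none) fun c hc => ?_
  obtain ⟨x, hx, hxc⟩ := List.mem_filterMap.1 hc
  have h1 := hw.prefix_of_mem_subtreeVerts (hl.mem_subtreeVerts rfl hx)
  have h2 : word w <+: word x := by
    by_contra h
    simp [letterAfter_eq_none_iff.2 h] at hxc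
  obtain rfl := hw.injective (h1.eq_of_length (le_antisymm h1.length_le h2.length_le))
  simpa [letterAfter, eq_comm] using hxc

/-- The path from `w` ends with the whole list `L`, and what precedes `L` cannot lower the count. -/
theorem IsLevelList.labelChanges_leafChainParent {L : List V} (hL : IsLevelList word m L)
    (hw : IsWordTree word) (hLw : L.map word = bitReversal m) {w : V} (hwm : (word w).length < m) :
    2 ^ (m - (word w).length) ≤
      labelChanges (fun x => letterAfter (word w) (word x)) (leafChainParent word L) w + 1 := by
  obtain ⟨a, ha⟩ := hL.exists_rootPath hw hwm
  rw [labelChanges, ha.eq_rootPath, ← alternations_bitReversal hwm, ← hLw, List.filterMap_map,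
    List.filterMap_append]
  exact Nat.add_le_add_right (alternations_le_append _ _) 1

/-- If a word tree contains all words of length at most `m`, then the diameter of its rotation graph
is at least `(m - 1) 2 ^ (m - 1)`. -/
theorem IsWordTree.le_diam [Fintype V] (hw : IsWordTree word) (hm : m ≠ 0)
    (hfull : ∀ l : List Bool, l.length ≤ m → ∃ x, word x = l) :
    m * 2 ^ m ≤ 2 * (rotationGraph (wordGraph word)).diam + 2 ^ m := by
  have : Nonempty V := ⟨(hfull [] (by simp)).choose⟩
  obtain ⟨L, hLw, hL⟩ := hw.exists_level (m := m) fun l hl => hfull l hl.le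
  have h := (isSeparatedLabelling_letterAfter hw
    (Finset.univ.filter fun x => (word x).length < m)).sum_le_diam hw.isTree
    (hL.isElimTree hw hm).toSearchTree hw.isElimTree_wordParent.toSearchTree
  simp only [IsElimTree.toSearchTree, hw.labelChanges_wordParent, Finset.sum_const_zero,
    zero_add] at h
  -- Sum by levels: there are `2 ^ j` words of length `j`, each contributing at least `2 ^ (m - j) -
  -- 1`, so every level accounts for `2 ^ m` up to the correction.
  have hfib : ∀ g : ℕ → ℕ, ∑ w ∈ Finset.univ.filter (fun x => (word x).length < m),
      g (word w).length = ∑ j ∈ Finset.range m, 2 ^ j * g j := by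
    intro g
    rw [← Finset.sum_fiberwise_of_maps_to (t := Finset.range m) (g := fun x => (word x).length)
      (by simp)]
    refine Finset.sum_congr rfl fun j hj => ?_
    rw [Finset.sum_congr rfl (g := fun _ => g j) (by simp +contextual), Finset.sum_const,
      smul_eq_mul, Finset.filter_filter, ← hw.card_level (m := j) fun l hl => hfull l
        (by have := Finset.mem_range.1 hj; omega)]
    congr 2
    ext x
    simp only [Finset.mem_filter, Finset.mem_univ, true_and, and_iff_right_iff_imp]
    rintro rfl
    exact Finset.mem_range.1 hj
  have h1 : ∑ w ∈ Finset.univ.filter (fun x => (word x).length < m), 2 ^ (m - (word w).length) ≤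
      ∑ w ∈ Finset.univ.filter (fun x => (word x).length < m),
        (labelChanges (fun x => letterAfter (word w) (word x)) (leafChainParent word L) w + 1) :=
    Finset.sum_le_sum fun w hw' =>
      hL.labelChanges_leafChainParent hw hLw (Finset.mem_filter.1 hw').2
  rw [Finset.sum_add_distrib, hfib fun j => 2 ^ (m - j), hfib fun _ => 1] at h1
  have h2 : ∑ j ∈ Finset.range m, 2 ^ j * 2 ^ (m - j) = m * 2 ^ m := by
    rw [Finset.sum_congr rfl (g := fun _ => 2 ^ m), Finset.sum_const, Finset.card_range,
      smul_eq_mul]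
    intro j hj
    rw [← pow_add]
    congr 1
    have := Finset.mem_range.1 hj
    omega
  have h3 : ∑ j ∈ Finset.range m, 2 ^ j * 1 ≤ 2 ^ m := by
    simp only [mul_one]
    exact (Nat.geomSum_lt le_rfl (by simp)).le
  omega

end LowerBound

/-! ### Trees of every size, and existence of the maximum -/

section Existence

/-- The words of length at most `m` can be completed to a prefix-closed set of any larger size. -/
theorem exists_prefixClosed_card (m n : ℕ) (hn : 2 ^ (m + 1) - 1 ≤ n) :
    ∃ P : Finset (List Bool), P.card = n ∧ (∀ l b, l ++ [b] ∈ P → l ∈ P) ∧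
      ∀ l : List Bool, l.length ≤ m → l ∈ P := by
  classical
  have hbase : ∃ P : Finset (List Bool), P.card ≤ n ∧ (∀ l b, l ++ [b] ∈ P → l ∈ P) ∧
      ∀ l : List Bool, l.length ≤ m → l ∈ P := by
    refine ⟨(Finset.range (m + 1)).biUnion fun j => (bitReversal j).toFinset, ?_, ?_, ?_⟩
    · refine Finset.card_biUnion_le.trans (le_trans ?_ hn)
      refine (Finset.sum_le_sum fun j _ => ((bitReversal j).toFinset_card_le).trans_eq
        (length_bitReversal j)).trans ?_
      exact Nat.le_sub_one_of_lt (Nat.geomSum_lt le_rfl (by simp))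
    · intro l b h
      simp only [Finset.mem_biUnion, Finset.mem_range, List.mem_toFinset, mem_bitReversal,
        List.length_append, List.length_singleton] at h ⊢
      obtain ⟨j, hj, hlj⟩ := h
      exact ⟨l.length, by omega, rfl⟩
    · intro l hl
      simp only [Finset.mem_biUnion, Finset.mem_range, List.mem_toFinset, mem_bitReversal]
      exact ⟨l.length, by omega, rfl⟩
  obtain ⟨P, hP, hclosed, hfull⟩ := hbase
  clear hn
  induction n, hP using Nat.le_induction with
  | base => exact ⟨P, rfl, hclosed, hfull⟩
  | succ n _ ih =>
    obtain ⟨Q, hQ, hQclosed, hQfull⟩ := ih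
    -- Extending a longest word gives a word not yet in `Q` and keeps the set prefix-closed.
    obtain ⟨l, hl, hmax⟩ := Q.exists_max_image List.length ⟨[], hQfull [] (by simp)⟩
    have hnot : l ++ [false] ∉ Q := fun h => by
      have := hmax _ h
      simp at this
    refine ⟨insert (l ++ [false]) Q, by rw [Finset.card_insert_of_notMem hnot, hQ], ?_,
      fun k hk => Finset.mem_insert_of_mem (hQfull k hk)⟩
    intro k b hk
    rcases Finset.mem_insert.1 hk with h | h
    · rw [List.append_inj_left' h rfl]
      exact Finset.mem_insert_of_mem hl
    · exact Finset.mem_insert_of_mem (hQclosed k b h)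

theorem exists_isTree_le_diam {m n : ℕ} (hm : m ≠ 0) (hn : 2 ^ (m + 1) - 1 ≤ n) :
    ∃ G : SimpleGraph (Fin n), G.IsTree ∧ m * 2 ^ m ≤ 2 * (rotationGraph G).diam + 2 ^ m := by
  obtain ⟨P, hP, hclosed, hfull⟩ := exists_prefixClosed_card m n hn
  let e := P.equivFinOfCardEq hP
  let word : Fin n → List Bool := fun i => (e.symm i).1
  have hsurj : ∀ l ∈ P, ∃ x, word x = l := fun l hl => ⟨e ⟨l, hl⟩, by simp [word]⟩
  have hw : IsWordTree word := ⟨Subtype.val_injective.comp e.symm.injective, fun x l b hx =>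
    hsurj l (hclosed l b (hx ▸ (e.symm x).2))⟩
  have : Nonempty (Fin n) := ⟨(hsurj [] (hfull [] (by simp))).choose⟩
  exact ⟨wordGraph word, hw.isTree, hw.le_diam hm fun l hl => hsurj l (hfull l hl)⟩

theorem completeBinaryTree_le_diam {m : ℕ} (hm : m ≠ 0) :
    m * 2 ^ m ≤ 2 * (rotationGraph (completeBinaryTree (m + 1))).diam + 2 ^ m := by
  have : Fintype {w : List Bool // w.length < m + 1} :=
    (List.finite_length_lt Bool (m + 1)).fintype
  have hw : IsWordTree (Subtype.val : {w : List Bool // w.length < m + 1} → List Bool) := by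
    refine ⟨Subtype.val_injective, fun x l b hx => ⟨⟨l, ?_⟩, rfl⟩⟩
    have := x.2
    simp only [hx, List.length_append, List.length_singleton] at this
    omega
  -- The complete binary tree is by definition the word graph of the inclusion of its vertices into
  -- the words.
  exact hw.le_diam hm fun l hl => ⟨⟨l, Nat.lt_succ_of_le hl⟩, rfl⟩

/-- The largest diameter of the rotation graph of a tree on `n` vertices is attained. -/
theorem exists_isGreatest_ediam {n : ℕ} (hn : 1 ≤ n) : ∃ D : ℕ,
    IsGreatest {d : ℕ∞ | ∃ G : SimpleGraph (Fin n), G.IsTree ∧ (rotationGraph G).ediam = d}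
      (D : ℕ∞) := by
  have : Nonempty (Fin n) := ⟨⟨0, hn⟩⟩
  -- A spanning tree of the complete graph shows that the finite set of trees is nonempty, so a
  -- maximiser exists.
  obtain ⟨G₀, -, hG₀⟩ := (SimpleGraph.connected_top (V := Fin n)).exists_isTree_le
  obtain ⟨G, hG, hmax⟩ := Set.exists_max_image {G : SimpleGraph (Fin n) | G.IsTree}
    (fun G => (rotationGraph G).ediam) (Set.toFinite _) ⟨G₀, hG₀⟩
  have htop : (rotationGraph G).ediam ≠ ⊤ :=
    ne_top_of_le_ne_top (ENat.natCast_ne_top _) (ediam_rotationGraph_le hG)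
  obtain ⟨D, hD⟩ := ENat.ne_top_iff_exists.1 htop
  refine ⟨D, ⟨G, hG, hD.symm⟩, ?_⟩
  rintro _ ⟨G', hG', rfl⟩
  exact (hmax G' hG').trans_eq hD.symm

end Existence

/-! ### From explicit bounds to orders of magnitude -/

section Asymptotics

/-- A sequence with `m 2 ^ m ≤ 2 D n + 2 ^ m` whenever `2 ^ (m + 1) ≤ n + 1` grows at least like
`n log n`. -/
theorem isBigO_mul_log_of_le {D : ℕ → ℕ}
    (hD : ∀ m n : ℕ, m ≠ 0 → 2 ^ (m + 1) - 1 ≤ n → m * 2 ^ m ≤ 2 * D n + 2 ^ m) :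
    (fun n : ℕ => (n : ℝ) * Real.log n) =O[atTop] fun n => (D n : ℝ) := by
  refine IsBigO.of_bound 16 ?_
  filter_upwards [eventually_ge_atTop 64] with n hn
  have hn' : (64 : ℝ) ≤ n := by exact_mod_cast hn
  have hlog0 : 0 ≤ Real.log n := Real.log_nonneg (by linarith)
  rw [Real.norm_of_nonneg (by positivity), Real.norm_of_nonneg (by positivity)]
  obtain ⟨m, hm⟩ : ∃ m, Nat.log 2 n = m + 6 :=
    ⟨Nat.log 2 n - 6, (Nat.sub_add_cancel (Nat.le_log_of_pow_le one_lt_two (by simpa using hn))).symm⟩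
  have h1 : 2 ^ (m + 6) ≤ n := hm ▸ Nat.pow_log_le_self 2 (by omega)
  have h2 : n < 2 ^ (m + 7) := by
    have := Nat.lt_pow_succ_log_self one_lt_two n
    rwa [hm] at this
  -- This says `D n ≥ (m + 4) 2 ^ (m + 4)`, while `n log n ≤ (m + 7) 2 ^ (m + 7)`. The constant 16
  -- is `2 ^ 3` times the 2 in `m + 7 ≤ 2 (m + 4)`.
  have h3 : (m + 5) * 2 ^ (m + 5) ≤ 2 * D n + 2 ^ (m + 5) :=
    hD (m + 5) n (by omega) (le_trans (Nat.sub_le _ _) h1)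
  have h3' : ((m : ℝ) + 5) * 2 ^ (m + 5) ≤ 2 * D n + 2 ^ (m + 5) := by exact_mod_cast h3
  have h2' : (n : ℝ) ≤ 2 ^ (m + 7) := by exact_mod_cast h2.le
  have h4 : Real.log n ≤ m + 7 := by
    calc Real.log n ≤ Real.log (2 ^ (m + 7)) := Real.log_le_log (by linarith) h2'
      _ = (m + 7) * Real.log 2 := by rw [Real.log_pow]; push_cast; ring
      _ ≤ (m + 7) * 1 := by
        gcongr
        have := Real.log_two_lt_d9
        linarith
      _ = m + 7 := mul_one _
  have h5 : (0 : ℝ) < 2 ^ m := by positivity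
  calc (n : ℝ) * Real.log n ≤ 2 ^ (m + 7) * (m + 7) := by gcongr
    _ ≤ 16 * D n := by
      rw [pow_add] at h3' ⊢
      nlinarith [mul_nonneg h5.le (Nat.cast_nonneg (α := ℝ) m)]

theorem isBigO_mul_log_of_ge {D : ℕ → ℕ} (hD : ∀ n : ℕ, 1 ≤ n → D n ≤ 2 * (n * Nat.log 2 n)) :
    (fun n : ℕ => (D n : ℝ)) =O[atTop] fun n : ℕ => (n : ℝ) * Real.log n := by
  refine IsBigO.of_bound (2 / Real.log 2) ?_
  filter_upwards [eventually_ge_atTop 1] with n hn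
  have hn' : (1 : ℝ) ≤ n := by exact_mod_cast hn
  have hlog0 : 0 ≤ Real.log n := Real.log_nonneg hn'
  rw [Real.norm_of_nonneg (by positivity), Real.norm_of_nonneg (by positivity)]
  have h1 : (D n : ℝ) ≤ 2 * (n * Nat.log 2 n) := by exact_mod_cast hD n hn
  have h2 : (Nat.log 2 n : ℝ) ≤ Real.log n / Real.log 2 := Real.natLog_le_logb n 2
  calc (D n : ℝ) ≤ 2 * (n * Nat.log 2 n) := h1
    _ ≤ 2 * (n * (Real.log n / Real.log 2)) := by gcongr
    _ = _ := by ring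

end Asymptotics

/-! ### The theorem -/

theorem mainTheorem1 :
    (∃ D : ℕ → ℕ,
      (∀ n : ℕ, 1 ≤ n →
        IsGreatest
          {d : ℕ∞ | ∃ G : SimpleGraph (Fin n), G.IsTree ∧ (rotationGraph G).ediam = d}
          (D n : ℕ∞)) ∧
      (fun n : ℕ => (D n : ℝ)) =Θ[atTop] (fun n : ℕ => (n : ℝ) * Real.log n)) ∧
    ((fun k : ℕ => ((2 : ℝ) ^ k - 1) * Real.log ((2 : ℝ) ^ k - 1)) =O[atTop]
      (fun k : ℕ => ((rotationGraph (completeBinaryTree k)).diam : ℝ))) := by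
  refine ⟨?_, ?_⟩
  · choose! D hD using fun (n : ℕ) (hn : 1 ≤ n) => exists_isGreatest_ediam hn
    refine ⟨D, hD, isBigO_mul_log_of_ge fun n hn => ?_, isBigO_mul_log_of_le fun m n hm hn => ?_⟩
    · obtain ⟨G, hG, hGD⟩ := (hD n hn).1
      have := ediam_rotationGraph_le hG
      rw [hGD, Fintype.card_fin] at this
      exact_mod_cast this
    · obtain ⟨G, hG, hle⟩ := exists_isTree_le_diam hm hn
      have h1 : 1 ≤ n := le_trans (Nat.le_sub_one_of_lt (Nat.one_lt_two_pow (by omega))) hn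
      have h2 : (rotationGraph G).diam ≤ D n := ENat.toNat_le_of_le_natCast ((hD n h1).2 ⟨G, hG, rfl⟩)
      omega
  · refine IsBigO.of_bound 16 ?_
    filter_upwards [eventually_ge_atTop 3] with k hk
    obtain ⟨m, rfl⟩ : ∃ m, k = m + 3 := ⟨k - 3, by omega⟩
    -- With `k = m + 3` levels the longest words have length `m + 2`. The diameter is thus at least
    -- `(m + 1) 2 ^ (m + 1)`, and 16 suffices because `m + 3 ≤ 4 (m + 1)`.
    have h1 : (m + 2) * 2 ^ (m + 2) ≤
        2 * (rotationGraph (completeBinaryTree (m + 3))).diam + 2 ^ (m + 2) :=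
      completeBinaryTree_le_diam (m := m + 2) (by omega)
    have h1' : ((m : ℝ) + 2) * 2 ^ (m + 2) ≤
        2 * (rotationGraph (completeBinaryTree (m + 3))).diam + 2 ^ (m + 2) := by exact_mod_cast h1
    have h2 : (1 : ℝ) ≤ 2 ^ m := one_le_pow₀ one_le_two
    have h3 : (2 : ℝ) ^ (m + 3) = 8 * 2 ^ m := by ring
    have h4 : (1 : ℝ) ≤ 2 ^ (m + 3) - 1 := by linarith
    have hlog0 := Real.log_nonneg h4
    rw [Real.norm_of_nonneg (by positivity), Real.norm_of_nonneg (by positivity)]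
    have h5 : Real.log ((2 : ℝ) ^ (m + 3) - 1) ≤ m + 3 := by
      calc Real.log ((2 : ℝ) ^ (m + 3) - 1) ≤ Real.log (2 ^ (m + 3)) :=
            Real.log_le_log (by linarith) (by linarith)
        _ = (m + 3) * Real.log 2 := by rw [Real.log_pow]; push_cast; ring
        _ ≤ (m + 3) * 1 := by
          gcongr
          have := Real.log_two_lt_d9
          linarith
        _ = m + 3 := mul_one _
    calc ((2 : ℝ) ^ (m + 3) - 1) * Real.log ((2 : ℝ) ^ (m + 3) - 1)
        ≤ 2 ^ (m + 3) * (m + 3) := by gcongr; linarith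
      _ ≤ _ := by
        rw [h3]
        rw [pow_add] at h1'
        nlinarith [mul_nonneg (zero_le_one.trans h2) (Nat.cast_nonneg (α := ℝ) m)]
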